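/- Let $(X,d)$ be a proper geodesic metric space that is $\delta$-hyperbolic for some $\delta\ge 0$: each point on a side of any geodesic triangle is within distance $\delta$ of the union of the other two sides. Let $\partial X$ be the Gromov boundary, i.e. the set of classes of sequences with $(x_i|x_j)_w\to\infty$ as $i,j\to\infty$, two such sequences being equivalent if $(x_i|y_i)_w\to\infty$, where $(x|y)_w=\frac12(d(x,w)+d(y,w)-d(x,y))$. Assume that $X$ has a pole: there are $L\ge 0$ and $o\in X\cup\partial X$ such that every point of $X$ is within distance $L$ of some geodesic joining $o$ to a point of $\partial X$ (a geodesic ray if $o\in X$, a bi-infinite geodesic if $o\in\partial X$). Fix $w\in X$ and $0<\varepsilon<1$ with $5\delta\varepsilon<1$, and let $d_{w,\varepsilon}$ be the visual metric on $\partial X$, $$d_{w,\varepsilon}(\xi,\zeta)=\inf\Big\{\sum_{i=1}^n e^{-\varepsilon(\xi_{i-1}|\xi_i)_w} : n\ge 1,\ \xi=\xi_0,\xi_1,\dots,\xi_n=\zeta\in\partial X\Big\},$$ where $(\xi|\zeta)_w=\inf\{\liminf_{i\to\infty}(x_i|y_i)_w : \{x_i\}\in\xi,\ \{y_i\}\in\zeta\}$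 and $e^{-\infty}=0$. A map $f:X\to Y$ of metric spaces is a $(K,C)$-quasi-isometric embedding ($K\ge1$, $C\ge0$) if $K^{-1}d(x,y)-C\le d(f(x),f(y))\le Kd(x,y)+C$ for all $x,y$, and a $(K,C)$-quasi-isometry if moreover every point of $Y$ is within distance $C$ of $f(X)$. Its induced map $\partial f:\partial X\to\partial Y$ is $[\{x_i\}]\mapsto[\{f(x_i)\}]$. A geodesic metric space $Y$ is geodesically rich if there are constants $r_0,\dots,r_4$ such that (i) for all $p,q\in Y$ with $d(p,q)\ge r_0$ there is a bi-infinite geodesic $\gamma$ with $d(p,\gamma)<r_1$ and $|d(q,\gamma)-d(p,q)|<r_2$; and (ii) for every bi-infinite geodesic $\gamma$ and every $p\in Y$ there is a bi-infinite geodesic $\gamma'$ with $d(p,\gamma')<r_3$ and $|d(p,\gamma)-d(\gamma',\gamma)|<r_4$, where $d(\gamma',\gamma)$ is the infimum of the distances between points of $\gamma'$ and $\gamma$. Then the following are equivalent: 1. There are a geodesically rich space $Y$ that is $\delta'$-hyperbolic for some $\delta'\ge 0$ and a quasi-isometric embedding $f:X\to Y$ whose induced map $\partial f:\partial X\to\partial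 Y$ is a bijection. 2. $X$ is geodesically rich. 3. $(\partial X,d_{w,\varepsilon})$ is uniformly perfect: there are $S\ge1$ and $r_0>0$ such that for all $\xi\in\partial X$ and $0<r\le r_0$ there is $\zeta\in\partial X$ with $r/S<d_{w,\varepsilon}(\xi,\zeta)\le r$. 4. $X$ is boundary rigid: every quasi-isometry $f:X\to X$ (with any constants) whose induced map on $\partial X$ is the identity satisfies $\sup_{x\in X}d(x,f(x))<\infty$. -/

import Mathlib

universe u v

namespace GromovHyp

section Geodesics

variable {X : Type u} [MetricSpace X]

/-- `γ`, restricted to `I`, is an isometric embedding of `I` into `X`, parametrised by arc length. -/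
def IsGeodesicOn (γ : ℝ → X) (I : Set ℝ) : Prop :=
  ∀ s ∈ I, ∀ t ∈ I, dist (γ s) (γ t) = |s - t|

/-- `σ` is (the image of) a geodesic segment `[x, y]`. -/
def IsGeodesicSegment (σ : Set X) (x y : X) : Prop :=
  ∃ γ : ℝ → X, IsGeodesicOn γ (Set.Icc 0 (dist x y)) ∧ γ 0 = x ∧ γ (dist x y) = y ∧
    σ = γ '' Set.Icc 0 (dist x y)

/-- `σ` is (the image of) a bi-infinite geodesic. -/
def IsGeodesicLine (σ : Set X) : Prop :=
  ∃ γ : ℝ → X, IsGeodesicOn γ Set.univ ∧ σ = Set.range γ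

variable (X) in
/-- Any two points are joined by a geodesic segment. -/
def IsGeodesicSpace : Prop :=
  ∀ x y : X, ∃ σ : Set X, IsGeodesicSegment σ x y

variable (X) in
/-- `δ`-hyperbolicity: each point on a side of a geodesic triangle is within `δ` of the other two
sides. (All triangles are quantified over, so it is enough to speak of the side `[x, y]`.) -/
def IsDeltaHyperbolic (δ : ℝ) : Prop :=
  0 ≤ δ ∧ ∀ (x y z : X) (a b c : Set X),
    IsGeodesicSegment a x y → IsGeodesicSegment b y z → IsGeodesicSegment c x z →
      ∀ p ∈ a, ∃ q ∈ b ∪ c, dist p q ≤ δ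

/-- The distance `inf {d(a, b) : a ∈ A, b ∈ B}` between two nonempty sets. -/
noncomputable def setDist (A B : Set X) : ℝ :=
  sInf (Set.image2 dist A B)

variable (X) in
/-- Geodesically rich metric spaces. -/
def IsGeodesicallyRich : Prop :=
  IsGeodesicSpace X ∧ ∃ r₀ r₁ r₂ r₃ r₄ : ℝ,
    (∀ p q : X, r₀ ≤ dist p q → ∃ σ : Set X, IsGeodesicLine σ ∧
      Metric.infDist p σ < r₁ ∧ |Metric.infDist q σ - dist p q| < r₂) ∧
    (∀ (σ : Set X) (p : X), IsGeodesicLine σ → ∃ τ : Set X, IsGeodesicLine τ ∧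
      Metric.infDist p τ < r₃ ∧ |Metric.infDist p σ - setDist τ σ| < r₄)

end Geodesics

section Boundary

variable {X : Type u} [MetricSpace X]

/-- The Gromov product `(x|y)_w`. -/
noncomputable def gromovProd (w x y : X) : ℝ :=
  (dist x w + dist y w - dist x y) / 2

/-- Gromov sequences. Changing the base point changes Gromov products by a bounded amount, so
requiring the condition at one or at every base point is the same. -/
def IsGromovSeq (x : ℕ → X) : Prop :=
  ∀ w : X, Filter.Tendsto (fun p : ℕ × ℕ => gromovProd w (x p.1) (x p.2)) Filter.atTop Filter.atTop

variable (X) in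
/-- The type of Gromov sequences in `X`. -/
def GromovSeq : Type u := {x : ℕ → X // IsGromovSeq x}

/-- Equivalence of Gromov sequences. -/
def GromovSeq.Equivalent (x y : GromovSeq X) : Prop :=
  ∀ w : X, Filter.Tendsto (fun i : ℕ => gromovProd w (x.1 i) (y.1 i)) Filter.atTop Filter.atTop

variable (X) in
/-- The Gromov boundary `∂X`: Gromov sequences modulo equivalence. In a Gromov hyperbolic space
`GromovSeq.Equivalent` is an equivalence relation, and the points are its classes. -/
def GromovBoundary : Type u := Quot (GromovSeq.Equivalent (X := X))

/-- `x` is a Gromov sequence in the class `ξ`. -/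
def Represents (x : ℕ → X) (ξ : GromovBoundary X) : Prop :=
  ∃ h : IsGromovSeq x, (Quot.mk _ (⟨x, h⟩ : GromovSeq X) : GromovBoundary X) = ξ

/-- The Gromov product of two boundary points, with values in `[0, ∞]`. -/
noncomputable def boundaryProd (w : X) (ξ ζ : GromovBoundary X) : EReal :=
  sInf {t : EReal | ∃ x y : ℕ → X, Represents x ξ ∧ Represents y ζ ∧
    t = Filter.liminf (fun i : ℕ => ((gromovProd w (x i) (y i) : ℝ) : EReal)) Filter.atTop}

open scoped Classical in
/-- `ρ_{w,ε}(ξ,ζ) = exp(-ε (ξ|ζ)_w)`, with `exp(-∞) = 0`. -/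
noncomputable def visualRho (w : X) (ε : ℝ) (ξ ζ : GromovBoundary X) : ℝ :=
  if boundaryProd w ξ ζ = ⊤ then 0 else Real.exp (-ε * (boundaryProd w ξ ζ).toReal)

/-- The visual metric `d_{w,ε}` on `∂X`: infimum of the `ρ_{w,ε}`-lengths of finite chains. -/
noncomputable def visualDist (w : X) (ε : ℝ) (ξ ζ : GromovBoundary X) : ℝ :=
  sInf {t : ℝ | ∃ (n : ℕ) (c : ℕ → GromovBoundary X), 1 ≤ n ∧ c 0 = ξ ∧ c n = ζ ∧
    t = ∑ i ∈ Finset.range n, visualRho w ε (c i) (c (i + 1))}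

/-- Uniform perfectness of a set `Z` with distance function `d`. -/
def IsUniformlyPerfect {Z : Type u} (d : Z → Z → ℝ) : Prop :=
  ∃ S : ℝ, 1 ≤ S ∧ ∃ r₀ : ℝ, 0 < r₀ ∧
    ∀ x : Z, ∀ r : ℝ, 0 < r → r ≤ r₀ → ∃ y : Z, r / S < d x y ∧ d x y ≤ r

/-- `σ` is a geodesic joining the point `o` of the Gromov closure `X ∪ ∂X` to `η ∈ ∂X`: a geodesic
ray if `o ∈ X`, a bi-infinite geodesic if `o ∈ ∂X`. -/
def GeodesicJoins (σ : Set X) : X ⊕ GromovBoundary X → GromovBoundary X → Prop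
  | Sum.inl o, η => ∃ γ : ℝ → X, IsGeodesicOn γ (Set.Ici 0) ∧ σ = γ '' Set.Ici 0 ∧ γ 0 = o ∧
      Represents (fun n : ℕ => γ n) η
  | Sum.inr ξ, η => ∃ γ : ℝ → X, IsGeodesicOn γ Set.univ ∧ σ = Set.range γ ∧
      Represents (fun n : ℕ => γ (-n)) ξ ∧ Represents (fun n : ℕ => γ n) η

variable (X) in
/-- `X` has a pole, in `X` or in `∂X`. -/
def HasPole : Prop :=
  ∃ L : ℝ, 0 ≤ L ∧ ∃ o : X ⊕ GromovBoundary X, ∀ x : X,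
    ∃ (η : GromovBoundary X) (σ : Set X), GeodesicJoins σ o η ∧ Metric.infDist x σ ≤ L

end Boundary

section Maps

variable {X : Type u} {Y : Type v} [MetricSpace X] [MetricSpace Y]

/-- `(K, C)`-quasi-isometric embeddings. -/
def IsQIEmbedding (K C : ℝ) (f : X → Y) : Prop :=
  1 ≤ K ∧ 0 ≤ C ∧ ∀ x y : X,
    K⁻¹ * dist x y - C ≤ dist (f x) (f y) ∧ dist (f x) (f y) ≤ K * dist x y + C

/-- `(K, C)`-quasi-isometries. -/
def IsQuasiIsometry (K C : ℝ) (f : X → Y) : Prop :=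
  IsQIEmbedding K C f ∧ ∀ y : Y, ∃ x : X, dist y (f x) ≤ C

/-- `F : ∂X → ∂Y` is the boundary map `∂f`, that is `∂f [x_i] = [f(x_i)]`. -/
def InducesBoundaryMap (f : X → Y) (F : GromovBoundary X → GromovBoundary Y) : Prop :=
  ∀ (x : ℕ → X) (ξ : GromovBoundary X), Represents x ξ → Represents (f ∘ x) (F ξ)

variable (X) in
/-- Boundary rigidity: every self quasi-isometry inducing the identity on `∂X` has finite
displacement. -/
def IsBoundaryRigid : Prop :=
  ∀ (K C : ℝ) (f : X → X), IsQuasiIsometry K C f → InducesBoundaryMap f id →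
    ∃ M : ℝ, ∀ x : X, dist x (f x) ≤ M

end Maps

/-- `X` quasi-isometrically embeds into a geodesically rich Gromov hyperbolic space `Y`, with
induced boundary map a bijection `∂X → ∂Y`. (`Y` ranges over every universe containing that
of `X`.) -/
def EmbedsInRichSpace (X : Type u) [MetricSpace X] : Prop :=
  ∃ (Y : Type (max u v)) (_ : MetricSpace Y),
    IsGeodesicallyRich Y ∧ (∃ δ' : ℝ, IsDeltaHyperbolic Y δ') ∧
      ∃ (K C : ℝ) (f : X → Y) (F : GromovBoundary X → GromovBoundary Y),
        IsQIEmbedding K C f ∧ InducesBoundaryMap f F ∧ Function.Bijective F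

end GromovHyp

/-! Slim triangles give the four-point inequality for Gromov products, and boundary points are
handled through representing sequences. The hub of the proof is `BranchesUniformly w`: seen from
`w`, every boundary point has, at each large height `t`, another one parting from it at height `t`
up to a bounded error. Since `5 * δ * ε < 1`, Frink's chain inequality makes the visual metric
comparable with `exp (-ε (ξ|ζ)_w)`, so branching is uniform perfectness in logarithmic coordinates.

The pole says that every point lies roughly on the way from `w` to some boundary point (`IsVisual`).
Branching off that direction at two well separated heights near `p` makes `p` a coarse centre of an
ideal triangle (`IsCenteredByTriples`). Richness follows: from `p`, at most one of the three ends
points towards a given `q`, and a line joining the other two passes near `p` and goes away from `q`.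
Rigidity follows too: by stability of quasi-geodesics `f p` is a centre of the image triple, and
when the ends are fixed `p` is a centre of it as well; two centres of one triple are close.

If `X` embeds in a rich space `Y`, take `p` at height `t` on the way to a boundary point. A line of
`Y` near `f p` that avoids the direction of `f w` has an end avoiding the direction of that boundary
point as well; pulled back by surjectivity of the boundary map, this end branches off near `p`.

If branching fails, there are arbitrarily long ranges of heights over which some geodesic from `w`
has an isolated tube around it. Sliding points along infinitely many such tubes, with the ends held
fixed, is a quasi-isometry that is the identity on the boundary but has unbounded displacement, so
`X` is not rigid. -/

namespace GromovHyp

/-! ### Gromov products and the four-point condition -/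

section FourPoint

variable {X : Type u} [MetricSpace X]

variable (X) in
/-- The four-point condition `min {(x|y)_w, (y|z)_w} - δ ≤ (x|z)_w`. -/
def FourPoint (δ : ℝ) : Prop :=
  0 ≤ δ ∧ ∀ w x y z : X, gromovProd w x y ≤ gromovProd w x z + δ ∨
    gromovProd w y z ≤ gromovProd w x z + δ

lemma gromovProd_comm (w x y : X) : gromovProd w x y = gromovProd w y x := by
  simp only [gromovProd, dist_comm x y]; ring

lemma gromovProd_nonneg (w x y : X) : 0 ≤ gromovProd w x y := by
  have := dist_triangle_right x y w
  simp only [gromovProd]; linarith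

lemma gromovProd_le_left (w x y : X) : gromovProd w x y ≤ dist x w := by
  have := dist_triangle y x w
  simp only [gromovProd]; linarith [dist_comm x y]

lemma gromovProd_le_right (w x y : X) : gromovProd w x y ≤ dist y w := by
  rw [gromovProd_comm]; exact gromovProd_le_left w y x

lemma gromovProd_self (w x : X) : gromovProd w x x = dist x w := by
  simp [gromovProd]

lemma gromovProd_base_le (w v x y : X) : gromovProd w x y ≤ gromovProd v x y + dist v w := by
  have h1 := dist_triangle x v w
  have h2 := dist_triangle y v w
  simp only [gromovProd]; linarith

lemma gromovProd_right_le (w x y z : X) : gromovProd w x y ≤ gromovProd w x z + dist y z := by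
  have h1 := dist_triangle y z w
  have h2 := dist_triangle x y z
  simp only [gromovProd]; linarith

lemma gromovProd_left_le (w x y z : X) : gromovProd w x y ≤ gromovProd w z y + dist x z := by
  rw [gromovProd_comm w x y, gromovProd_comm w z y]; exact gromovProd_right_le w y x z

lemma gromovProd_add (w x y : X) : gromovProd w x y + gromovProd x w y = dist x w := by
  simp only [gromovProd, dist_comm x w, dist_comm y w, dist_comm x y]; ring

/-- Change of base point. -/
lemma gromovProd_change_base (p w x y : X) :
    gromovProd p x y = gromovProd w x y + dist p w - gromovProd w p x - gromovProd w p y := by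
  simp only [gromovProd, dist_comm x p, dist_comm y p]; ring

lemma dist_eq_gromovProd (w x y : X) :
    dist x y = dist x w + dist y w - 2 * gromovProd w x y := by
  simp only [gromovProd]; ring

lemma FourPoint.chain {δ : ℝ} (h : FourPoint X δ) (w x y z u : X) :
    gromovProd w x y ≤ gromovProd w x u + 2 * δ ∨ gromovProd w y z ≤ gromovProd w x u + 2 * δ ∨
      gromovProd w z u ≤ gromovProd w x u + 2 * δ := by
  have h0 := h.1
  rcases h.2 w x y u with h1 | h1
  · left; linarith
  · rcases h.2 w y z u with h2 | h2
    · right; left; linarith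
    · right; right; linarith

/-- If every point of a path from `A` to `B` is `R`-close to `A ∪ B`, some point of it is
`R`-close to both. -/
lemma exists_near_both {γ : ℝ → X} {l R : ℝ} (hl : 0 ≤ l) (hγ : ContinuousOn γ (Set.Icc 0 l))
    {A B : Set X} (hA : IsCompact A) (hB : IsCompact B) (h0 : γ 0 ∈ A) (h1 : γ l ∈ B)
    (h : ∀ s ∈ Set.Icc 0 l, ∃ q ∈ A ∪ B, dist (γ s) q ≤ R) :
    ∃ s ∈ Set.Icc 0 l, ∃ a ∈ A, ∃ b ∈ B, dist (γ s) a ≤ R ∧ dist (γ s) b ≤ R := by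
  have hc : ContinuousOn (fun s => Metric.infDist (γ s) A - Metric.infDist (γ s) B)
      (Set.Icc 0 l) :=
    ((Metric.continuous_infDist_pt A).comp_continuousOn hγ).sub
      ((Metric.continuous_infDist_pt B).comp_continuousOn hγ)
  have hz : (0 : ℝ) ∈ Set.Icc (Metric.infDist (γ 0) A - Metric.infDist (γ 0) B)
      (Metric.infDist (γ l) A - Metric.infDist (γ l) B) := by
    rw [Metric.infDist_zero_of_mem h0, Metric.infDist_zero_of_mem h1]
    have := @Metric.infDist_nonneg _ _ B (γ 0)
    have := @Metric.infDist_nonneg _ _ A (γ l)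
    constructor <;> linarith
  obtain ⟨s, hs, hs0⟩ := intermediate_value_Icc hl hc hz
  have hs0 : Metric.infDist (γ s) A - Metric.infDist (γ s) B = 0 := hs0
  obtain ⟨a, ha, hda⟩ := hA.exists_infDist_eq_dist ⟨_, h0⟩ (γ s)
  obtain ⟨b, hb, hdb⟩ := hB.exists_infDist_eq_dist ⟨_, h1⟩ (γ s)
  refine ⟨s, hs, a, ha, b, hb, ?_⟩
  obtain ⟨q, hq, hqR⟩ := h s hs
  rcases hq with hq | hq
  · have := Metric.infDist_le_dist_of_mem (x := γ s) hq
    constructor <;> linarith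
  · have := Metric.infDist_le_dist_of_mem (x := γ s) hq
    constructor <;> linarith

lemma IsGeodesicOn.continuousOn {γ : ℝ → X} {I : Set ℝ} (h : IsGeodesicOn γ I) :
    ContinuousOn γ I := by
  have : LipschitzOnWith 1 γ I := LipschitzOnWith.of_dist_le_mul fun x hx y hy => by
    rw [h x hx y hy, Real.dist_eq]; simp
  exact this.continuousOn

lemma IsGeodesicOn.mono {γ : ℝ → X} {I J : Set ℝ} (h : IsGeodesicOn γ I) (hJ : J ⊆ I) :
    IsGeodesicOn γ J := fun s hs t ht => h s (hJ hs) t (hJ ht)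

lemma IsGeodesicSpace.exists_path (h : IsGeodesicSpace X) (x y : X) :
    ∃ γ : ℝ → X, IsGeodesicOn γ (Set.Icc 0 (dist x y)) ∧ γ 0 = x ∧ γ (dist x y) = y := by
  obtain ⟨_, γ, h1, h2, h3, _⟩ := h x y
  exact ⟨γ, h1, h2, h3⟩

lemma IsGeodesicSegment.isCompact {σ : Set X} {x y : X} (h : IsGeodesicSegment σ x y) :
    IsCompact σ := by
  obtain ⟨γ, h1, h2, h3, rfl⟩ := h
  exact isCompact_Icc.image_of_continuousOn h1.continuousOn

lemma IsGeodesicSegment.right_mem {σ : Set X} {x y : X} (h : IsGeodesicSegment σ x y) :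
    y ∈ σ := by
  obtain ⟨γ, h1, h2, h3, rfl⟩ := h
  exact ⟨_, ⟨dist_nonneg, le_rfl⟩, h3⟩

lemma IsGeodesicSegment.dist_add {σ : Set X} {x y p : X} (h : IsGeodesicSegment σ x y)
    (hp : p ∈ σ) : dist x p + dist p y = dist x y := by
  obtain ⟨γ, h1, h2, h3, rfl⟩ := h
  obtain ⟨s, hs, rfl⟩ := hp
  have a := h1 0 ⟨le_rfl, dist_nonneg⟩ s hs
  have b := h1 s hs _ ⟨dist_nonneg, le_rfl⟩
  rw [h2] at a; rw [h3] at b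
  rw [a, b, abs_of_nonpos (by linarith [hs.1]), abs_of_nonpos (by linarith [hs.2])]
  ring

lemma IsGeodesicSegment.symm {σ : Set X} {x y : X} (h : IsGeodesicSegment σ x y) :
    IsGeodesicSegment σ y x := by
  obtain ⟨γ, h1, h2, h3, rfl⟩ := h
  rw [IsGeodesicSegment, dist_comm y x]
  refine ⟨fun s => γ (dist x y - s), ?_, by simpa using h3, by simpa using h2, ?_⟩
  · intro s hs t ht
    rw [h1 _ ⟨by linarith [hs.2], by linarith [hs.1]⟩ _ ⟨by linarith [ht.2], by linarith [ht.1]⟩,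
      abs_sub_comm]
    congr 1; ring
  · ext p; constructor
    · rintro ⟨s, hs, rfl⟩
      exact ⟨dist x y - s, ⟨by linarith [hs.2], by linarith [hs.1]⟩, by simp⟩
    · rintro ⟨s, hs, rfl⟩
      exact ⟨dist x y - s, ⟨by linarith [hs.2], by linarith [hs.1]⟩, by simp⟩

/-- A side `[x, y]` of a `δ`-slim triangle contains a point at distance at most `(x|y)_w + 2δ`
from the opposite vertex `w`. -/
lemma IsDeltaHyperbolic.exists_dist_le {δ : ℝ} (h : IsDeltaHyperbolic X δ)
    (hg : IsGeodesicSpace X) {σ : Set X} {x y : X} (hσ : IsGeodesicSegment σ x y) (w : X) :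
    ∃ p ∈ σ, dist p w ≤ gromovProd w x y + 2 * δ := by
  obtain ⟨b, hb⟩ := hg w y
  obtain ⟨c, hc⟩ := hg w x
  have key := h.2 x y w σ b c hσ hb.symm hc.symm
  obtain ⟨γ, h1, h2, h3, hσ'⟩ := id hσ
  obtain ⟨s, hs, q, hq, r, hr, hsq, hsr⟩ := exists_near_both (R := δ) dist_nonneg h1.continuousOn
    hc.isCompact hb.isCompact (by rw [h2]; exact hc.right_mem) (by rw [h3]; exact hb.right_mem)
    (fun s hs => by
      obtain ⟨q, hq, hqd⟩ := key (γ s) (by rw [hσ']; exact ⟨s, hs, rfl⟩)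
      exact ⟨q, hq.symm, hqd⟩)
  have hmem : γ s ∈ σ := by rw [hσ']; exact ⟨s, hs, rfl⟩
  refine ⟨γ s, hmem, ?_⟩
  have e1 := hσ.dist_add hmem
  have e2 := hc.dist_add hq
  have e3 := hb.dist_add hr
  have t1 := dist_triangle (γ s) q w
  have t2 := dist_triangle (γ s) r w
  have t3 := dist_triangle (γ s) q x
  have t4 := dist_triangle (γ s) r y
  simp only [gromovProd]
  linarith [dist_comm q w, dist_comm r w, dist_comm x w, dist_comm y w, dist_comm (γ s) x]

lemma IsGeodesicSegment.gromovProd_le {σ : Set X} {x y p : X} (hσ : IsGeodesicSegment σ x y)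
    (hp : p ∈ σ) (w : X) : gromovProd w x y ≤ dist p w := by
  have e1 := hσ.dist_add hp
  have t1 := dist_triangle x p w
  have t2 := dist_triangle y p w
  simp only [gromovProd]; linarith [dist_comm y p]

/-- The side `[x, z]` comes within `(x|z)_w + 2δ` of `w`; slimness moves this point by `δ` onto `[x,
y]` or `[y, z]`, whose distance from `w` bounds the corresponding Gromov product from above. -/
lemma IsDeltaHyperbolic.fourPoint {δ : ℝ} (h : IsDeltaHyperbolic X δ)
    (hg : IsGeodesicSpace X) : FourPoint X (3 * δ) := by
  refine ⟨by linarith [h.1], fun w x y z => ?_⟩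
  obtain ⟨a, ha⟩ := hg x z
  obtain ⟨b, hb⟩ := hg y z
  obtain ⟨c, hc⟩ := hg x y
  obtain ⟨p, hp, hpw⟩ := h.exists_dist_le hg ha w
  obtain ⟨q, hq, hpq⟩ := h.2 x z y a b c ha hb.symm hc p hp
  have t := dist_triangle q p w
  rw [dist_comm q p] at t
  rcases hq with hq | hq
  · right; linarith [hb.gromovProd_le hq w]
  · left; linarith [hc.gromovProd_le hq w]

/-- The point of a geodesic `[x, y]` at distance `(p|y)_x` from `x` is near `p`. -/
lemma FourPoint.dist_path_le {δ : ℝ} (h : FourPoint X δ) {γ : ℝ → X} {x y : X}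
    (hγ : IsGeodesicOn γ (Set.Icc 0 (dist x y))) (h0 : γ 0 = x) (h1 : γ (dist x y) = y)
    (p : X) : gromovProd x p y ∈ Set.Icc 0 (dist x y) ∧
      dist p (γ (gromovProd x p y)) ≤ gromovProd p x y + 2 * δ := by
  have hmem : gromovProd x p y ∈ Set.Icc 0 (dist x y) :=
    ⟨gromovProd_nonneg _ _ _, by rw [dist_comm]; exact gromovProd_le_right _ _ _⟩
  refine ⟨hmem, ?_⟩
  set t := gromovProd x p y with ht
  have a := hγ 0 ⟨le_rfl, dist_nonneg⟩ t hmem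
  have b := hγ t hmem _ ⟨dist_nonneg, le_rfl⟩
  rw [h0, abs_of_nonpos (by linarith [hmem.1])] at a
  rw [h1, abs_of_nonpos (by linarith [hmem.2])] at b
  have hd := h.1
  -- Both `(p|y)_x` and `(y|γ t)_x` equal `t`, so `(p|γ t)_x ≥ t - δ`, which is the claimed distance
  -- bound.
  have := h.2 x p y (γ t)
  rw [← ht] at this
  simp only [gromovProd] at this ht ⊢
  rcases this with h2 | h2 <;>
  linarith [dist_comm p x, dist_comm p y, dist_comm (γ t) x, dist_comm (γ t) y, dist_comm y x]

/-- If `q` is a nearly closest point to `p` on a geodesic from `q` to `y`, then `(p|y)_q` is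
small. -/
lemma FourPoint.gromovProd_le_of_nearest {δ e : ℝ} (h : FourPoint X δ) {p q y : X} {σ : Set X}
    (hσ : IsGeodesicSegment σ q y) (hq : ∀ z ∈ σ, dist p q ≤ dist p z + e) :
    gromovProd q p y ≤ e + 2 * δ := by
  obtain ⟨γ, h1, h2, h3, rfl⟩ := hσ
  obtain ⟨hm, hd⟩ := h.dist_path_le h1 h2 h3 p
  have := hq _ ⟨_, hm, rfl⟩
  have e := gromovProd_add p q y
  have c := gromovProd_add q p y
  linarith [dist_comm p q]

/-- At most one of two directions with small Gromov product is close to a third. -/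
lemma FourPoint.le_or_le {δ C : ℝ} (h : FourPoint X δ) {p x y : X} (q : X)
    (hxy : gromovProd p x y ≤ C) : gromovProd p x q ≤ C + δ ∨ gromovProd p y q ≤ C + δ := by
  rcases h.2 p x q y with h1 | h1
  · left; linarith
  · right; rw [gromovProd_comm]; linarith

/-- Two centres of a triple of points are near each other. -/
lemma FourPoint.dist_center_le {δ C : ℝ} (h : FourPoint X δ) {p q a b c : X}
    (h1 : gromovProd p a b ≤ C) (h2 : gromovProd p b c ≤ C) (h3 : gromovProd p a c ≤ C)
    (h4 : gromovProd q a b ≤ C) (h5 : gromovProd q b c ≤ C) (h6 : gromovProd q a c ≤ C) :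
    dist p q ≤ 3 * C + 2 * δ := by
  have key : ∀ a b : X, gromovProd q a b ≤ C → gromovProd p a q ≤ C + δ →
      gromovProd p b q ≤ C + δ → dist p q ≤ 3 * C + 2 * δ := by
    intro a b h4 ha hb
    have e := gromovProd_change_base q p a b
    have := gromovProd_nonneg p a b
    rw [gromovProd_comm p q a, gromovProd_comm p q b] at e
    linarith [dist_comm p q]
  -- Seen from `p`, at most one of `a`, `b`, `c` lies in the direction of `q`. For the other two,
  -- changing the base point from `p` to `q` raises their product by nearly `dist p q`, yet it stays
  -- at most `C`.
  rcases h.le_or_le q h1 with ha | hb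
  · rcases h.le_or_le q h2 with hb | hc
    · exact key a b h4 ha hb
    · exact key a c h6 ha hc
  · rcases h.le_or_le q h3 with ha | hc
    · exact key a b h4 ha hb
    · exact key b c h5 hb hc

end FourPoint

/-! ### Stability of quasi-geodesics -/

section Stability

variable {X : Type u} {Y : Type v} [MetricSpace X] [MetricSpace Y]

/-- Along a chain of `2 ^ k` steps Gromov products drop by at most `k δ`. -/
lemma FourPoint.le_gromovProd_chain {δ A : ℝ} (h : FourPoint Y δ) (p : Y) (c : ℕ → Y) (k : ℕ) :
    ∀ i j : ℕ, i < j → j ≤ i + 2 ^ k →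
      (∀ m, i ≤ m → m < j → A ≤ gromovProd p (c m) (c (m + 1))) →
      A - k * δ ≤ gromovProd p (c i) (c j) := by
  induction k with
  | zero =>
    intro i j hij hj hA
    obtain rfl : j = i + 1 := by simp at hj; omega
    simpa using hA i le_rfl (by omega)
  | succ k ih =>
    intro i j hij hj hA
    have h0 := h.1
    rw [pow_succ] at hj
    push_cast
    rcases le_or_gt j (i + 2 ^ k) with hjk | hjk
    · have := ih i j hij hjk hA
      linarith
    · have p0 : 0 < 2 ^ k := by positivity
      have h1 := ih i (i + 2 ^ k) (by omega) le_rfl (fun m hm hm' => hA m hm (by omega))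
      have h2 := ih (i + 2 ^ k) j hjk (by omega) (fun m hm hm' => hA m (by omega) hm')
      rcases h.2 p (c i) (c (i + 2 ^ k)) (c j) with h3 | h3 <;> linarith

/-- Exponential growth beats linear growth: `k` is about `log₂ (7aR)` and `log R = o(R)`. In the
stability argument `6aR + a` bounds the number of steps of a detour around a ball of radius `R`, and
`(k + 2)δ` is what the four-point condition loses along it. -/
lemma exists_linear_le_two_pow {a B δ : ℝ} (ha : 1 ≤ a) (hδ : 0 ≤ δ) :
    ∃ R₀ : ℝ, 0 ≤ R₀ ∧ ∀ R, R₀ < R → ∃ k : ℕ, 6 * a * R + a ≤ 2 ^ k ∧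
      B / 2 + (k + 2) * δ < R := by
  have hl2 : 0 < Real.log 2 := Real.log_pos (by norm_num)
  have hc : 0 < Real.log 2 / (2 * (δ + 1)) := by positivity
  have hb := Real.isLittleO_log_id_atTop.bound hc
  obtain ⟨R₁, hR₁⟩ := Filter.eventually_atTop.1 hb
  set q : ℝ := Real.log (7 * a) / Real.log 2 with hq
  refine ⟨max (max R₁ 1) (2 * (B / 2 + (q + 3) * δ)), by positivity, fun R hR => ?_⟩
  have hRa : R₁ < R := lt_of_le_of_lt ((le_max_left _ _).trans (le_max_left _ _)) hR
  have hRb : 1 < R := lt_of_le_of_lt ((le_max_right _ _).trans (le_max_left _ _)) hR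
  have hRc : 2 * (B / 2 + (q + 3) * δ) < R := lt_of_le_of_lt (le_max_right _ _) hR
  have hlog := hR₁ R hRa.le
  have hlR : 0 ≤ Real.log R := Real.log_nonneg hRb.le
  simp only [id, Real.norm_eq_abs, abs_of_nonneg hlR, abs_of_pos (by linarith : 0 < R)] at hlog
  set x : ℝ := Real.log (7 * a * R) / Real.log 2 with hx
  have hpos : 0 < 7 * a * R := by positivity
  have hx0 : 0 ≤ x := div_nonneg (Real.log_nonneg (by nlinarith)) hl2.le
  have hxe : (2 : ℝ) ^ x = 7 * a * R := by
    rw [Real.rpow_def_of_pos (by norm_num), hx, mul_div_cancel₀ _ hl2.ne', Real.exp_log hpos]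
  have hxq : x = q + Real.log R / Real.log 2 := by
    rw [hx, Real.log_mul (by positivity) (by positivity), add_div]
  have hxR : δ * (Real.log R / Real.log 2) ≤ R / 2 := by
    have h1 : Real.log R / Real.log 2 ≤ R / (2 * (δ + 1)) := by
      rw [div_le_iff₀ hl2]
      calc _ ≤ _ := hlog
        _ = _ := by ring
    calc δ * (Real.log R / Real.log 2) ≤ (δ + 1) * (Real.log R / Real.log 2) := by
          apply mul_le_mul_of_nonneg_right (by linarith); positivity
      _ ≤ (δ + 1) * (R / (2 * (δ + 1))) := by gcongr
      _ = R / 2 := by field_simp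
  refine ⟨⌈x⌉₊, ?_, ?_⟩
  · calc 6 * a * R + a ≤ 7 * a * R := by nlinarith
      _ = (2 : ℝ) ^ x := hxe.symm
      _ ≤ (2 : ℝ) ^ ((⌈x⌉₊ : ℕ) : ℝ) :=
        Real.rpow_le_rpow_of_exponent_le (by norm_num) (Nat.le_ceil x)
      _ = _ := Real.rpow_natCast _ _
  · have := Nat.ceil_lt_add_one hx0
    have h3 : ((⌈x⌉₊ : ℝ) + 2) * δ ≤ (x + 3) * δ :=
      mul_le_mul_of_nonneg_right (by linarith) hδ
    rw [hxq] at h3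
    nlinarith

lemma isGeodesicOn_gromovProd_eq_zero {γ : ℝ → Y} {I : Set ℝ} (h : IsGeodesicOn γ I)
    {r s t : ℝ} (hr : r ∈ I) (hs : s ∈ I) (ht : t ∈ I) (hrs : r ≤ s) (hst : s ≤ t) :
    gromovProd (γ s) (γ r) (γ t) = 0 := by
  rw [gromovProd, h r hr s hs, h t ht s hs, h r hr t ht, abs_of_nonpos (by linarith),
    abs_of_nonneg (by linarith), abs_of_nonpos (by linarith)]
  ring

/-- A geodesic stays near any discrete quasi-geodesic with the same end points. -/
lemma FourPoint.exists_infDist_chain_le {δ a B : ℝ} (h : FourPoint Y δ) (ha : 1 ≤ a)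
    (hB : 0 ≤ B) : ∃ R : ℝ, 0 ≤ R ∧ ∀ (N : ℕ) (c : ℕ → Y) (γ : ℝ → Y),
      (∀ i, i < N → dist (c i) (c (i + 1)) ≤ B) →
      (∀ i j, i ≤ N → j ≤ N → |(i : ℝ) - j| ≤ a * dist (c i) (c j) + a) →
      IsGeodesicOn γ (Set.Icc 0 (dist (c 0) (c N))) → γ 0 = c 0 →
      γ (dist (c 0) (c N)) = c N →
      ∀ s ∈ Set.Icc 0 (dist (c 0) (c N)), ∃ i ≤ N, dist (γ s) (c i) ≤ R := by
  obtain ⟨R₀, hR₀, hk⟩ := exists_linear_le_two_pow (B := B) ha h.1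
  refine ⟨R₀, hR₀, fun N c γ hstep hq hγ h0 h1 => ?_⟩
  set l := dist (c 0) (c N) with hl
  set S : Set Y := c '' Set.Iic N with hS
  have hSc : IsCompact S := ((Set.finite_Iic N).image c).isCompact
  have hSn : S.Nonempty := ⟨c 0, 0, Nat.zero_le _, rfl⟩
  have hl0 : 0 ≤ l := dist_nonneg
  obtain ⟨s₀, hs₀, hmax⟩ := isCompact_Icc.exists_isMaxOn (Set.nonempty_Icc.2 hl0)
    ((Metric.continuous_infDist_pt S).comp_continuousOn hγ.continuousOn)
  have hatt : ∀ y : Y, ∃ i ≤ N, dist y (c i) = Metric.infDist y S := fun y => by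
    obtain ⟨_, ⟨i, hi, rfl⟩, he⟩ := hSc.exists_infDist_eq_dist hSn y
    exact ⟨i, hi, he.symm⟩
  set R := Metric.infDist (γ s₀) S with hR
  have hmax' : ∀ s ∈ Set.Icc 0 l, Metric.infDist (γ s) S ≤ R := fun s hs => hmax hs
  suffices hRR : R ≤ R₀ by
    intro s hs
    obtain ⟨i, hi, he⟩ := hatt (γ s)
    exact ⟨i, hi, by rw [he]; exact (hmax' s hs).trans hRR⟩
  by_contra! hcon
  obtain ⟨k, hk1, hk2⟩ := hk R hcon
  have hRpos : 0 < R := lt_of_le_of_lt hR₀ hcon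
  have hfar : ∀ i ≤ N, R ≤ dist (γ s₀) (c i) := fun i hi =>
    Metric.infDist_le_dist_of_mem ⟨i, hi, rfl⟩
  set p := γ s₀ with hp
  -- Let `p` be a point of the geodesic farthest from the chain. Go `2R` back and forth along the
  -- geodesic, or to its end, and jump to the chain: this gives a detour outside the ball of radius
  -- `R` about `p` with few steps. Hence `(γ s₁|γ s₂)_p > 0`, although `p` lies between `γ s₁` and
  -- `γ s₂`.
  obtain ⟨s₁, hs₁, hs₁₀, hs₁', i, hi, hi1, hi2⟩ : ∃ s₁ ∈ Set.Icc 0 l, s₁ ≤ s₀ ∧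
      s₀ - s₁ ≤ 2 * R ∧ ∃ i ≤ N, dist (γ s₁) (c i) ≤ R ∧ R ≤ gromovProd p (γ s₁) (c i) := by
    rcases le_or_gt (2 * R) s₀ with hc | hc
    · have hm : s₀ - 2 * R ∈ Set.Icc 0 l := ⟨by linarith, by linarith [hs₀.2]⟩
      obtain ⟨i, hi, he⟩ := hatt (γ (s₀ - 2 * R))
      have hd := hγ _ hm _ hs₀
      rw [abs_of_nonpos (by linarith)] at hd
      refine ⟨_, hm, by linarith, by linarith, i, hi, by rw [he]; exact hmax' _ hm, ?_⟩
      have := hmax' _ hm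
      have := hfar i hi
      simp only [gromovProd]
      rw [he, hd, dist_comm (c i)]
      linarith
    · refine ⟨0, ⟨le_rfl, hl0⟩, hs₀.1, by linarith, 0, Nat.zero_le _, by rw [h0]; simp; linarith, ?_⟩
      rw [h0, gromovProd_self, dist_comm]
      exact hfar 0 (Nat.zero_le _)
  obtain ⟨s₂, hs₂, hs₂₀, hs₂', j, hj, hj1, hj2⟩ : ∃ s₂ ∈ Set.Icc 0 l, s₀ ≤ s₂ ∧
      s₂ - s₀ ≤ 2 * R ∧ ∃ j ≤ N, dist (γ s₂) (c j) ≤ R ∧ R ≤ gromovProd p (c j) (γ s₂) := by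
    rcases le_or_gt (s₀ + 2 * R) l with hc | hc
    · have hm : s₀ + 2 * R ∈ Set.Icc 0 l := ⟨by linarith [hs₀.1], by linarith⟩
      obtain ⟨i, hi, he⟩ := hatt (γ (s₀ + 2 * R))
      have hd := hγ _ hm _ hs₀
      rw [abs_of_nonneg (by linarith)] at hd
      refine ⟨_, hm, by linarith, by linarith, i, hi, by rw [he]; exact hmax' _ hm, ?_⟩
      have := hmax' _ hm
      have := hfar i hi
      simp only [gromovProd]
      linarith [dist_comm (c i) (γ (s₀ + 2 * R)), dist_comm (c i) (γ s₀)]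
    · refine ⟨l, ⟨hl0, le_rfl⟩, hs₀.2, by linarith, N, le_rfl, by rw [h1]; simp; linarith, ?_⟩
      rw [h1, gromovProd_self, dist_comm]
      exact hfar N le_rfl
  have hyy := hγ _ hs₁ _ hs₂
  rw [abs_of_nonpos (by linarith)] at hyy
  have hcc : dist (c i) (c j) ≤ 6 * R := by
    have t1 := dist_triangle4 (c i) (γ s₁) (γ s₂) (c j)
    linarith [dist_comm (c i) (γ s₁)]
  have hij := hq i j hi hj
  have hijk : |(i : ℝ) - j| ≤ 2 ^ k := by
    refine hij.trans (le_trans ?_ hk1)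
    nlinarith
  have hchain : ∀ i j : ℕ, i < j → j ≤ N → |(i : ℝ) - j| ≤ 2 ^ k →
      R - B / 2 - k * δ ≤ gromovProd p (c i) (c j) := by
    intro i j hij hj hijk
    refine h.le_gromovProd_chain p c k i j hij ?_ fun m hm hmj => ?_
    · rw [abs_of_nonpos (by simp; exact_mod_cast hij.le)] at hijk
      have : (j : ℝ) ≤ i + 2 ^ k := by linarith
      exact_mod_cast this
    · have a1 := hfar m (by omega)
      have a2 := hfar (m + 1) (by omega)
      have a3 := hstep m (by omega)
      simp only [gromovProd]
      linarith [dist_comm p (c m), dist_comm p (c (m + 1))]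
  have hfin : R - B / 2 - k * δ ≤ gromovProd p (c i) (c j) := by
    rcases lt_trichotomy i j with hlt | heq | hgt
    · exact hchain i j hlt hj hijk
    · subst heq
      rw [gromovProd_self, dist_comm]
      have := hfar i hi
      have : 0 ≤ (k : ℝ) * δ := mul_nonneg (Nat.cast_nonneg _) h.1
      linarith
    · rw [gromovProd_comm]
      exact hchain j i hgt hi (by rwa [abs_sub_comm])
  have hz := isGeodesicOn_gromovProd_eq_zero hγ hs₁ hs₀ hs₂ hs₁₀ hs₂₀
  have hkδ : 0 ≤ (k : ℝ) * δ := mul_nonneg (Nat.cast_nonneg _) h.1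
  have hd := h.1
  rcases h.chain p (γ s₁) (c i) (c j) (γ s₂) with h3 | h3 | h3 <;> linarith

/-- A discrete quasi-geodesic stays near any geodesic with the same end points. -/
lemma FourPoint.exists_dist_path_chain_le {δ a B : ℝ} (h : FourPoint Y δ) (ha : 1 ≤ a)
    (hB : 0 ≤ B) : ∃ R : ℝ, 0 ≤ R ∧ ∀ (N : ℕ) (c : ℕ → Y) (γ : ℝ → Y),
      (∀ i j, i ≤ N → j ≤ N → dist (c i) (c j) ≤ B * |(i : ℝ) - j|) →
      (∀ i j, i ≤ N → j ≤ N → |(i : ℝ) - j| ≤ a * dist (c i) (c j) + a) →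
      IsGeodesicOn γ (Set.Icc 0 (dist (c 0) (c N))) → γ 0 = c 0 →
      γ (dist (c 0) (c N)) = c N →
      ∀ k ≤ N, ∃ s ∈ Set.Icc 0 (dist (c 0) (c N)), dist (c k) (γ s) ≤ R := by
  obtain ⟨R, hR, hmain⟩ := h.exists_infDist_chain_le ha hB
  refine ⟨B * (a * (2 * R) + a) + R, by positivity, fun N c γ hB' hq hγ h0 h1 k hk => ?_⟩
  have hnear := hmain N c γ (fun i hi => by simpa using hB' i (i + 1) hi.le hi) hq hγ h0 h1
  -- By connectedness some `γ s` is near both a term with index `i ≤ k` and one with index `j ≥ k`.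
  -- Those terms are close, so `j - i` is bounded and `c k` is close to them.
  obtain ⟨s, hs, _, ⟨i, hi, rfl⟩, _, ⟨j, hj, rfl⟩, hsi, hsj⟩ := exists_near_both (R := R)
    (A := c '' Set.Iic k) (B := c '' Set.Icc k N) dist_nonneg hγ.continuousOn
    ((Set.finite_Iic k).image c).isCompact ((Set.finite_Icc k N).image c).isCompact
    (by rw [h0]; exact ⟨0, Nat.zero_le _, rfl⟩) (by rw [h1]; exact ⟨N, ⟨hk, le_rfl⟩, rfl⟩)
    (fun s hs => by
      obtain ⟨i, hi, hd⟩ := hnear s hs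
      rcases le_total i k with hik | hik
      · exact ⟨c i, Or.inl ⟨i, hik, rfl⟩, hd⟩
      · exact ⟨c i, Or.inr ⟨i, ⟨hik, hi⟩, rfl⟩, hd⟩)
  refine ⟨s, hs, ?_⟩
  have hik : i ≤ k := hi
  have hij := hq i j (hik.trans hk) hj.2
  have hcc := dist_triangle_left (c i) (c j) (γ s)
  have e1 : |(i : ℝ) - k| ≤ |(i : ℝ) - j| := by
    have a1 : (i : ℝ) ≤ k := by exact_mod_cast hik
    have a2 : (k : ℝ) ≤ j := by exact_mod_cast hj.1
    rw [abs_of_nonpos (by linarith), abs_of_nonpos (by linarith)]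
    linarith
  have e2 := hB' i k (hik.trans hk) hk
  have e3 := dist_triangle_left (c k) (γ s) (c i)
  have e4 : B * |(i : ℝ) - k| ≤ B * (a * (2 * R) + a) := by
    apply mul_le_mul_of_nonneg_left _ hB
    nlinarith
  linarith [dist_comm (γ s) (c i)]

/-- Stability of quasi-geodesics: quasi-isometric embeddings into a hyperbolic space preserve
betweenness up to a bounded error. -/
lemma IsQIEmbedding.exists_gromovProd_path_le {K C δ : ℝ} {f : X → Y} (hf : IsQIEmbedding K C f)
    (hgY : IsGeodesicSpace Y) (h : FourPoint Y δ) :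
    ∃ D : ℝ, 0 ≤ D ∧ ∀ (x y : X) (γ : ℝ → X), IsGeodesicOn γ (Set.Icc 0 (dist x y)) → γ 0 = x →
      γ (dist x y) = y → ∀ t ∈ Set.Icc 0 (dist x y),
        gromovProd (f (γ t)) (f x) (f y) ≤ D := by
  obtain ⟨hK, hC, hf⟩ := hf
  obtain ⟨R, hR, hmain⟩ := h.exists_dist_path_chain_le (a := K + K * C + 1) (B := K + C)
    (by nlinarith) (by linarith)
  refine ⟨R + (K + C), by linarith, fun x y γ hγ h0 h1 t ht => ?_⟩
  set d := dist x y with hd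
  have hd0 : 0 ≤ d := dist_nonneg
  set N := ⌈d⌉₊ with hN
  -- Unit-step sampling; the truncation makes the last sample, of index `⌈d⌉`, the end point `f y`.
  set c : ℕ → Y := fun i => f (γ (min i d)) with hc
  have hmem : ∀ i : ℕ, min (i : ℝ) d ∈ Set.Icc 0 d := fun i =>
    ⟨le_min (Nat.cast_nonneg _) hd0, min_le_right _ _⟩
  have hc0 : c 0 = f x := by simp [hc, min_eq_left hd0, h0]
  have hcN : c N = f y := by simp [hc, min_eq_right (Nat.le_ceil d), h1, hN]
  have hdist : ∀ i j : ℕ, dist (γ (min i d)) (γ (min j d)) = |min (i : ℝ) d - min (j : ℝ) d| :=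
    fun i j => hγ _ (hmem i) _ (hmem j)
  have hB : ∀ i j, i ≤ N → j ≤ N → dist (c i) (c j) ≤ (K + C) * |(i : ℝ) - j| := by
    intro i j _ _
    rcases eq_or_ne i j with rfl | hij
    · simp
    · have h1 : (1 : ℝ) ≤ |(i : ℝ) - j| := by
        have : (1 : ℤ) ≤ |(i : ℤ) - j| := Int.one_le_abs (by omega)
        exact_mod_cast this
      have h2 := (hf (γ (min i d)) (γ (min j d))).2
      rw [hdist] at h2
      have h3 := abs_min_sub_min_le_max (i : ℝ) d j d
      rw [sub_self, abs_zero, max_eq_left (abs_nonneg _)] at h3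
      have : K * |min (i : ℝ) d - min (j : ℝ) d| ≤ K * |(i : ℝ) - j| := by gcongr
      simp only [hc]
      nlinarith
  have hq : ∀ i j, i ≤ N → j ≤ N →
      |(i : ℝ) - j| ≤ (K + K * C + 1) * dist (c i) (c j) + (K + K * C + 1) := by
    intro i j hi hj
    have h2 := (hf (γ (min i d)) (γ (min j d))).1
    rw [hdist] at h2
    have hlt : ∀ i : ℕ, i ≤ N → (i : ℝ) ≤ min (i : ℝ) d + 1 ∧ min (i : ℝ) d ≤ i := by
      intro i hi
      have : (i : ℝ) ≤ N := by exact_mod_cast hi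
      have := Nat.ceil_lt_add_one hd0
      refine ⟨?_, min_le_left _ _⟩
      rcases min_choice (i : ℝ) d with h | h <;> rw [h] <;> linarith
    obtain ⟨a1, a2⟩ := hlt i hi
    obtain ⟨b1, b2⟩ := hlt j hj
    have h3 : |(i : ℝ) - j| ≤ |min (i : ℝ) d - min (j : ℝ) d| + 1 := by
      rw [abs_le]
      have := abs_le.1 (le_refl |min (i : ℝ) d - min (j : ℝ) d|)
      constructor <;> linarith
    have h4 : |min (i : ℝ) d - min (j : ℝ) d| ≤ K * (dist (c i) (c j) + C) := by
      have h5 : K⁻¹ * |min (i : ℝ) d - min (j : ℝ) d| ≤ dist (c i) (c j) + C := by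
        simp only [hc]; linarith
      rwa [inv_mul_le_iff₀ (by linarith)] at h5
    have := @dist_nonneg _ _ (c i) (c j)
    nlinarith [mul_nonneg (mul_nonneg (by linarith : 0 ≤ K) hC) this]
  obtain ⟨g, g1, g2, g3⟩ := hgY.exists_path (c 0) (c N)
  have hkN : ⌊t⌋₊ ≤ N := (Nat.floor_le_floor ht.2).trans (Nat.floor_le_ceil d)
  obtain ⟨s, hs, hds⟩ := hmain N c g hB hq g1 g2 g3 _ hkN
  have hz := isGeodesicOn_gromovProd_eq_zero g1 ⟨le_rfl, dist_nonneg⟩ hs ⟨dist_nonneg, le_rfl⟩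
    hs.1 hs.2
  rw [g2, g3, hc0, hcN] at hz
  have hfl := Nat.floor_le ht.1
  have hfl' := Nat.lt_floor_add_one t
  have hdt : dist (c ⌊t⌋₊) (f (γ t)) ≤ K + C := by
    have h2 := (hf (γ (min ⌊t⌋₊ d)) (γ t)).2
    rw [hγ _ (hmem _) _ ht, min_eq_left (hfl.trans ht.2), abs_of_nonpos (by linarith)] at h2
    simp only [hc]
    rw [min_eq_left (hfl.trans ht.2)]
    nlinarith
  have b1 := gromovProd_base_le (f (γ t)) (g s) (f x) (f y)
  have b2 := dist_triangle_left (g s) (f (γ t)) (c ⌊t⌋₊)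
  linarith

/-- Quasi-isometric embeddings between hyperbolic spaces preserve smallness of Gromov products. -/
lemma IsQIEmbedding.exists_gromovProd_le {K C δ δ' : ℝ} {f : X → Y} (hf : IsQIEmbedding K C f)
    (hgX : IsGeodesicSpace X) (hX : FourPoint X δ) (hgY : IsGeodesicSpace Y)
    (hY : FourPoint Y δ') (c : ℝ) :
    ∃ D : ℝ, 0 ≤ D ∧ ∀ x y p : X, gromovProd p x y ≤ c →
      gromovProd (f p) (f x) (f y) ≤ D := by
  obtain ⟨D, hD, hmain⟩ := hf.exists_gromovProd_path_le hgY hY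
  obtain ⟨hK, hC, hf⟩ := hf
  have hδ := hX.1
  refine ⟨D + (K * (|c| + 2 * δ) + C), by positivity, fun x y p hp => ?_⟩
  obtain ⟨γ, g1, g2, g3⟩ := hgX.exists_path x y
  obtain ⟨hm, hd⟩ := hX.dist_path_le g1 g2 g3 p
  have h1 := hmain x y γ g1 g2 g3 _ hm
  have h2 := (hf p (γ (gromovProd x p y))).2
  have h3 := gromovProd_base_le (f p) (f (γ (gromovProd x p y))) (f x) (f y)
  have h4 : K * dist p (γ (gromovProd x p y)) ≤ K * (|c| + 2 * δ) := by
    gcongr; linarith [le_abs_self c]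
  linarith [dist_comm (f p) (f (γ (gromovProd x p y)))]

end Stability

/-! ### Gromov sequences and their classes -/

section Sequences

variable {X : Type u} [MetricSpace X]

lemma isGromovSeq_iff {x : ℕ → X} :
    IsGromovSeq x ↔ ∀ (w : X) (A : ℝ), ∃ N, ∀ m n, N ≤ m → N ≤ n →
      A ≤ gromovProd w (x m) (x n) := by
  refine forall_congr' fun w => ?_
  rw [Filter.tendsto_atTop]
  refine forall_congr' fun A => ?_
  rw [Filter.eventually_atTop]
  constructor
  · rintro ⟨⟨a, b⟩, h⟩
    exact ⟨max a b, fun m n hm hn => h (m, n) ⟨(le_max_left _ _).trans hm,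
      (le_max_right _ _).trans hn⟩⟩
  · rintro ⟨N, h⟩
    exact ⟨(N, N), fun p hp => h _ _ hp.1 hp.2⟩

/-- `x` and `y` are asymptotic: `(x_m|y_n)_w → ∞` as `m, n → ∞`, for every base point. -/
def Asymptotic (x y : ℕ → X) : Prop :=
  ∀ (w : X) (A : ℝ), ∃ N, ∀ m n, N ≤ m → N ≤ n → A ≤ gromovProd w (x m) (y n)

lemma IsGromovSeq.asymptotic_self {x : ℕ → X} (h : IsGromovSeq x) : Asymptotic x x :=
  isGromovSeq_iff.1 h

lemma Asymptotic.symm {x y : ℕ → X} (h : Asymptotic x y) : Asymptotic y x := fun w A => by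
  obtain ⟨N, hN⟩ := h w A
  exact ⟨N, fun m n hm hn => by rw [gromovProd_comm]; exact hN n m hn hm⟩

lemma Asymptotic.tendsto {x y : ℕ → X} (h : Asymptotic x y) (w : X) :
    Filter.Tendsto (fun i => gromovProd w (x i) (y i)) Filter.atTop Filter.atTop := by
  rw [Filter.tendsto_atTop]
  intro A
  obtain ⟨N, hN⟩ := h w A
  exact Filter.eventually_atTop.2 ⟨N, fun i hi => hN i i hi hi⟩

/-- A sequence whose points have large Gromov products with those of a Gromov sequence is an
asymptotic Gromov sequence. -/
lemma FourPoint.asymptotic_of_tendsto {δ : ℝ} (h : FourPoint X δ) {x y z : ℕ → X}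
    (hxy : Asymptotic x y)
    (hyz : ∀ w, Filter.Tendsto (fun i => gromovProd w (y i) (z i)) Filter.atTop Filter.atTop) :
    Asymptotic x z := fun w A => by
  obtain ⟨N, hN⟩ := hxy w (A + δ + 1)
  obtain ⟨M, hM⟩ := Filter.eventually_atTop.1 (Filter.tendsto_atTop.1 (hyz w) (A + δ + 1))
  refine ⟨max N M, fun m n hm hn => ?_⟩
  have h1 := hN m n ((le_max_left _ _).trans hm) ((le_max_left _ _).trans hn)
  have h2 := hM n ((le_max_right _ _).trans hn)
  rcases h.2 w (x m) (y n) (z n) with h3 | h3 <;> linarith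

lemma FourPoint.equivalent_equivalence {δ : ℝ} (h : FourPoint X δ) :
    Equivalence (GromovSeq.Equivalent (X := X)) where
  refl x := fun w => (IsGromovSeq.asymptotic_self x.2).tendsto w
  symm {x y} hxy := fun w => by
    simpa only [gromovProd_comm w (y.1 _) (x.1 _)] using hxy w
  trans {x y z} hxy hyz := fun w =>
    (h.asymptotic_of_tendsto (h.asymptotic_of_tendsto
      (IsGromovSeq.asymptotic_self x.2) hxy) hyz).tendsto w

/-- Equality in the `Quot` only yields the generated equivalence relation; hyperbolicity makes
`GromovSeq.Equivalent` transitive already, so nothing is added. -/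
lemma Represents.asymptotic {δ : ℝ} (h : FourPoint X δ) {x y : ℕ → X} {ξ : GromovBoundary X}
    (hx : Represents x ξ) (hy : Represents y ξ) : Asymptotic x y := by
  obtain ⟨hx, rfl⟩ := hx
  obtain ⟨hy, he⟩ := hy
  have := h.equivalent_equivalence.eqvGen_iff.1 (Quot.eqvGen_exact he.symm)
  exact h.asymptotic_of_tendsto hx.asymptotic_self this

lemma Represents.isGromovSeq {x : ℕ → X} {ξ : GromovBoundary X} (hx : Represents x ξ) :
    IsGromovSeq x := hx.1

lemma IsGromovSeq.exists_represents {x : ℕ → X} (hx : IsGromovSeq x) :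
    ∃ ξ : GromovBoundary X, Represents x ξ := ⟨_, hx, rfl⟩

lemma exists_represents (ξ : GromovBoundary X) : ∃ x : ℕ → X, Represents x ξ := by
  obtain ⟨x, rfl⟩ := Quot.exists_rep ξ
  exact ⟨x.1, x.2, rfl⟩

lemma FourPoint.isGromovSeq_of_asymptotic {δ : ℝ} (h : FourPoint X δ) {x y : ℕ → X}
    (hxy : Asymptotic x y) : IsGromovSeq y := by
  rw [isGromovSeq_iff]
  exact h.asymptotic_of_tendsto hxy.symm fun w => hxy.tendsto w

lemma FourPoint.represents_of_asymptotic {δ : ℝ} (h : FourPoint X δ) {x y : ℕ → X}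
    {ξ : GromovBoundary X} (hx : Represents x ξ) (hxy : Asymptotic x y) : Represents y ξ := by
  obtain ⟨hx, rfl⟩ := hx
  exact ⟨h.isGromovSeq_of_asymptotic hxy, Quot.sound fun w => hxy.symm.tendsto w⟩

/-- A free ultrafilter replaces passing to subsequences: the alternatives of the four-point
condition depend on `n`, but one of them holds for almost every `n`. -/
lemma eventually_hyperfilter_ge (N : ℕ) : ∀ᶠ n in (Filter.hyperfilter ℕ : Filter ℕ), N ≤ n :=
  Nat.hyperfilter_le_atTop (Filter.eventually_ge_atTop N)

lemma Asymptotic.eventually_le_dist {x y : ℕ → X} (h : Asymptotic x y) (w : X) (A : ℝ) :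
    ∃ N, ∀ n, N ≤ n → A ≤ dist (x n) w := by
  obtain ⟨N, hN⟩ := h w A
  exact ⟨N, fun n hn => (hN n n hn hn).trans (gromovProd_le_left _ _ _)⟩

/-- A lower bound along the ultrafilter for the Gromov products of two representatives gives one
for all representatives. -/
lemma FourPoint.exists_forall_ge_le_gromovProd {δ c : ℝ} (h : FourPoint X δ) {w : X}
    {x y x' y' : ℕ → X} (hx : Asymptotic x x') (hy : Asymptotic y y')
    (hc : ∀ᶠ n in (Filter.hyperfilter ℕ : Filter ℕ), c ≤ gromovProd w (x n) (y n)) :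
    ∃ N, ∀ n, N ≤ n → c - 2 * δ ≤ gromovProd w (x' n) (y' n) := by
  obtain ⟨N, hN⟩ := hx w (c + 1)
  obtain ⟨M, hM⟩ := hy w (c + 1)
  obtain ⟨m, hm, hmN, hmM⟩ := (hc.and ((eventually_hyperfilter_ge N).and
    (eventually_hyperfilter_ge M))).exists
  refine ⟨max N M, fun n hn => ?_⟩
  have h1 := hN m n hmN ((le_max_left _ _).trans hn)
  have h2 := hM m n hmM ((le_max_right _ _).trans hn)
  rw [gromovProd_comm] at h1
  rcases h.chain w (x' n) (x m) (y m) (y' n) with h3 | h3 | h3 <;> linarith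

end Sequences

/-! ### Boundary products and the visual metric -/

section BoundaryProd

variable {X : Type u} [MetricSpace X] {w : X} {x y : ℕ → X} {ξ η ζ : GromovBoundary X}
  {δ c ε : ℝ}

lemma boundaryProd_le (hx : Represents x ξ) (hy : Represents y ζ)
    (hc : ∀ᶠ n in (Filter.hyperfilter ℕ : Filter ℕ), gromovProd w (x n) (y n) ≤ c) :
    boundaryProd w ξ ζ ≤ c := by
  have hle : boundaryProd w ξ ζ ≤
      Filter.liminf (fun i : ℕ => ((gromovProd w (x i) (y i) : ℝ) : EReal)) Filter.atTop :=
    sInf_le ⟨x, y, hx, hy, rfl⟩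
  refine hle.trans (Filter.liminf_le_of_frequently_le ?_)
  refine Filter.Frequently.filter_mono ?_ Nat.hyperfilter_le_atTop
  exact (hc.mono fun n hn => by exact_mod_cast hn).frequently

lemma FourPoint.le_boundaryProd (h : FourPoint X δ) (hx : Represents x ξ) (hy : Represents y ζ)
    (hc : ∀ᶠ n in (Filter.hyperfilter ℕ : Filter ℕ), c ≤ gromovProd w (x n) (y n)) :
    ((c - 2 * δ : ℝ) : EReal) ≤ boundaryProd w ξ ζ := by
  refine le_sInf ?_
  rintro _ ⟨x', y', hx', hy', rfl⟩
  refine Filter.le_liminf_of_le (by isBoundedDefault) ?_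
  obtain ⟨N, hN⟩ := h.exists_forall_ge_le_gromovProd (hx.asymptotic h hx') (hy.asymptotic h hy') hc
  exact Filter.eventually_atTop.2 ⟨N, fun n hn => by exact_mod_cast hN n hn⟩

lemma eventually_le_of_le_boundaryProd (hx : Represents x ξ) (hy : Represents y ζ)
    (hc : (c : EReal) ≤ boundaryProd w ξ ζ) {c' : ℝ} (hc' : c' < c) :
    ∀ᶠ n in Filter.atTop, c' ≤ gromovProd w (x n) (y n) := by
  have h1 : (c : EReal) ≤
      Filter.liminf (fun i : ℕ => ((gromovProd w (x i) (y i) : ℝ) : EReal)) Filter.atTop :=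
    hc.trans (sInf_le ⟨x, y, hx, hy, rfl⟩)
  have h2 := Filter.eventually_lt_of_lt_liminf (lt_of_lt_of_le (EReal.coe_lt_coe_iff.2 hc') h1)
  exact h2.mono fun n hn => (EReal.coe_lt_coe_iff.1 hn).le

lemma boundaryProd_nonneg : 0 ≤ boundaryProd w ξ ζ := by
  refine le_sInf ?_
  rintro _ ⟨x', y', hx', hy', rfl⟩
  refine Filter.le_liminf_of_le (by isBoundedDefault) ?_
  exact Filter.Eventually.of_forall fun n => by exact_mod_cast gromovProd_nonneg _ _ _

lemma FourPoint.boundaryProd_chain (h : FourPoint X δ) (h1 : (c : EReal) ≤ boundaryProd w ξ η)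
    (h2 : (c : EReal) ≤ boundaryProd w η ζ) :
    ((c - δ : ℝ) : EReal) ≤ boundaryProd w ξ ζ := by
  refine le_sInf ?_
  rintro _ ⟨x, z, hx, hz, rfl⟩
  obtain ⟨y, hy⟩ := exists_represents η
  refine EReal.ge_of_forall_gt_iff_ge.1 fun a ha => ?_
  refine Filter.le_liminf_of_le (by isBoundedDefault) ?_
  have ha : a < c - δ := by exact_mod_cast ha
  filter_upwards [eventually_le_of_le_boundaryProd hx hy h1 (c' := a + δ) (by linarith),
    eventually_le_of_le_boundaryProd hy hz h2 (c' := a + δ) (by linarith)] with n hn1 hn2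
  rcases h.2 w (x n) (y n) (z n) with h3 | h3
  · exact_mod_cast (by linarith : a ≤ gromovProd w (x n) (z n))
  · exact_mod_cast (by linarith : a ≤ gromovProd w (x n) (z n))

lemma visualRho_nonneg : 0 ≤ visualRho w ε ξ ζ := by
  unfold visualRho; split_ifs <;> positivity

lemma visualRho_le_exp_iff (hε : 0 < ε) :
    visualRho w ε ξ ζ ≤ Real.exp (-ε * c) ↔ (c : EReal) ≤ boundaryProd w ξ ζ := by
  unfold visualRho
  split_ifs with h
  · simp [h, Real.exp_nonneg]
  · have hb : boundaryProd w ξ ζ ≠ ⊥ := fun hb => by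
      have := boundaryProd_nonneg (w := w) (ξ := ξ) (ζ := ζ)
      rw [hb] at this
      exact absurd this (by simp)
    rw [Real.exp_le_exp, ← EReal.coe_toReal h hb, EReal.coe_le_coe_iff]
    simp only [EReal.toReal_coe]
    constructor <;> intro h1 <;> nlinarith

/-- The four-point condition survives on the boundary with the same constant, and exponentiating
turns it into a quasi-ultrametric inequality. Testing against every `r` above the maximum avoids a
separate treatment of infinite products. -/
lemma FourPoint.visualRho_le_mul_max (h : FourPoint X δ) (hε : 0 < ε) :
    visualRho w ε ξ ζ ≤ Real.exp (ε * δ) * max (visualRho w ε ξ η) (visualRho w ε η ζ) := by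
  have key : ∀ r, max (visualRho w ε ξ η) (visualRho w ε η ζ) < r →
      (Real.exp (ε * δ))⁻¹ * visualRho w ε ξ ζ ≤ r := by
    intro r hr
    have hr0 : 0 < r := lt_of_le_of_lt (visualRho_nonneg.trans (le_max_left _ _)) hr
    obtain ⟨c, rfl⟩ : ∃ c, Real.exp (-ε * c) = r := ⟨-Real.log r / ε, by
      rw [show -ε * (-Real.log r / ε) = Real.log r by field_simp, Real.exp_log hr0]⟩
    have h1 := (visualRho_le_exp_iff hε).1 ((le_max_left _ _).trans hr.le)
    have h2 := (visualRho_le_exp_iff hε).1 ((le_max_right _ _).trans hr.le)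
    have h3 := (visualRho_le_exp_iff hε).2 (h.boundaryProd_chain h1 h2)
    rw [inv_mul_le_iff₀ (Real.exp_pos _), ← Real.exp_add]
    rwa [show ε * δ + -ε * c = -ε * (c - δ) by ring]
  have := le_of_forall_gt_imp_ge_of_dense key
  rwa [inv_mul_le_iff₀ (Real.exp_pos _)] at this

/-- Frink's chain inequality for a quasi-ultrametric with constant `K ≤ 2`. -/
lemma le_mul_sum_of_le_mul_max {Z : Type*} {ρ : Z → Z → ℝ} {K : ℝ} (hρ : ∀ a b, 0 ≤ ρ a b)
    (hK0 : 0 ≤ K) (hK : K ≤ 2) (h : ∀ a b c, ρ a c ≤ K * max (ρ a b) (ρ b c)) (c : ℕ → Z) (n : ℕ) :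
    ∀ i j, i + 2 + n = j → ρ (c i) (c j) ≤ K * (2 * ∑ k ∈ Finset.Ico i j, ρ (c k) (c (k + 1)) -
      ρ (c i) (c (i + 1)) - ρ (c (j - 1)) (c j)) := by
  induction n using Nat.strong_induction_on with
  | _ n ih =>
  intro i j hij
  have hfirst : ρ (c i) (c (i + 1)) + ρ (c (j - 1)) (c j) ≤
      ∑ k ∈ Finset.Ico i j, ρ (c k) (c (k + 1)) := by
    rw [Finset.sum_eq_sum_Ico_succ_bot (by omega)]
    gcongr
    have := Finset.single_le_sum (f := fun k => ρ (c k) (c (k + 1))) (fun k _ => hρ _ _)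
      (show j - 1 ∈ Finset.Ico (i + 1) j by simp; omega)
    simpa [show j - 1 + 1 = j by omega] using this
  by_cases hend : ρ (c i) (c j) ≤ K * ρ (c (j - 1)) (c j)
  · refine hend.trans (mul_le_mul_of_nonneg_left ?_ hK0)
    linarith [hρ (c i) (c (i + 1))]
  by_cases hbeg : ρ (c i) (c j) ≤ K * ρ (c i) (c (i + 1))
  · refine hbeg.trans (mul_le_mul_of_nonneg_left ?_ hK0)
    linarith [hρ (c (j - 1)) (c j)]
  have hch : ∀ p, ρ (c i) (c j) ≤ K * ρ (c i) (c p) ∨ ρ (c i) (c j) ≤ K * ρ (c p) (c j) := by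
    intro p
    have := h (c i) (c p) (c j)
    rcases max_choice (ρ (c i) (c p)) (ρ (c p) (c j)) with h1 | h1 <;> rw [h1] at this
    · exact Or.inl this
    · exact Or.inr this
  obtain ⟨p, hp1, hp2, hpr, hpl⟩ : ∃ p, i + 1 ≤ p ∧ p + 2 ≤ j ∧
      ρ (c i) (c j) ≤ K * ρ (c p) (c j) ∧ ρ (c i) (c j) ≤ K * ρ (c i) (c (p + 1)) := by
    -- Walk right from `i + 1` as long as `c p` stays far from `c j`; this must fail before `j - 1`,
    -- so some `p` is far from `c j` while `c (p + 1)` is far from `c i`. The pieces `[i, p + 1]`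
    -- and `[p, j]` overlap in one edge, and the subtracted end edges of the bound cancel exactly
    -- this double counting.
    by_contra! hcon
    have hall : ∀ q, i + 1 + q + 1 ≤ j → ρ (c i) (c j) ≤ K * ρ (c (i + 1 + q)) (c j) := by
      intro q
      induction q with
      | zero => intro _; exact (hch (i + 1)).resolve_left hbeg
      | succ q ihq =>
        intro hq
        have := hcon (i + 1 + q) (by omega) (by omega) (ihq (by omega))
        exact (hch (i + 1 + (q + 1))).resolve_left (not_le.2 this)
    refine hend ?_
    have := hall (j - 1 - (i + 1)) (by omega)
    rwa [show i + 1 + (j - 1 - (i + 1)) = j - 1 by omega] at this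
  have i1 := ih (p + 1 - (i + 2)) (by omega) i (p + 1) (by omega)
  have i2 := ih (j - (p + 2)) (by omega) p j (by omega)
  rw [show p + 1 - 1 = p by omega, Finset.sum_Ico_succ_top (by omega)] at i1
  rw [Finset.sum_eq_sum_Ico_succ_bot (by omega)] at i2
  rw [← Finset.sum_Ico_consecutive _ (show i ≤ p by omega) (show p ≤ j by omega),
    Finset.sum_eq_sum_Ico_succ_bot (show p < j by omega)]
  have hK2 : ρ (c i) (c j) ≤ K / 2 * ρ (c i) (c (p + 1)) + K / 2 * ρ (c p) (c j) := by
    linarith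
  have hle : K / 2 * ρ (c i) (c (p + 1)) + K / 2 * ρ (c p) (c j) ≤
      ρ (c i) (c (p + 1)) + ρ (c p) (c j) := by
    nlinarith [hρ (c i) (c (p + 1)), hρ (c p) (c j)]
  linarith

lemma visualDist_le_visualRho : visualDist w ε ξ ζ ≤ visualRho w ε ξ ζ := by
  refine csInf_le ⟨0, ?_⟩ ⟨1, fun i => if i = 0 then ξ else ζ, le_rfl, rfl, rfl, by simp⟩
  rintro _ ⟨n, c, _, _, _, rfl⟩
  exact Finset.sum_nonneg fun i _ => visualRho_nonneg

/-- Frink's inequality bounds `ρ` by `K * 2` times the length of any chain, and `K ≤ 2` gives the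
`4`. -/
lemma FourPoint.visualRho_le_visualDist (h : FourPoint X δ) (hε : 0 < ε)
    (hK : Real.exp (ε * δ) ≤ 2) : visualRho w ε ξ ζ ≤ 4 * visualDist w ε ξ ζ := by
  rw [mul_comm, ← div_le_iff₀ (by norm_num)]
  refine le_csInf ⟨_, 1, fun i => if i = 0 then ξ else ζ, le_rfl, rfl, rfl, rfl⟩ ?_
  rintro _ ⟨n, c, hn, rfl, rfl, rfl⟩
  have hs : 0 ≤ ∑ i ∈ Finset.range n, visualRho w ε (c i) (c (i + 1)) :=
    Finset.sum_nonneg fun i _ => visualRho_nonneg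
  rw [div_le_iff₀ (by norm_num)]
  rcases hn.eq_or_lt with rfl | hn
  · simp at hs ⊢; linarith
  · have := le_mul_sum_of_le_mul_max (ρ := visualRho w ε) (fun a b => visualRho_nonneg)
      (Real.exp_pos (ε * δ)).le hK (fun a b c => h.visualRho_le_mul_max hε) c (n - 2) 0 n (by omega)
    rw [← Finset.range_eq_Ico] at this
    refine this.trans ?_
    have h1 := visualRho_nonneg (w := w) (ε := ε) (ξ := c 0) (ζ := c (0 + 1))
    have h2 := visualRho_nonneg (w := w) (ε := ε) (ξ := c (n - 1)) (ζ := c n)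
    have : ∀ a : ℝ, a ≤ 2 * ∑ i ∈ Finset.range n, visualRho w ε (c i) (c (i + 1)) →
      Real.exp (ε * δ) * a ≤ 2 * (2 * ∑ i ∈ Finset.range n, visualRho w ε (c i) (c (i + 1))) :=
      fun a ha => (mul_le_mul_of_nonneg_left ha (Real.exp_pos _).le).trans
        (mul_le_mul_of_nonneg_right hK (by linarith))
    refine (this _ (by linarith)).trans (by linarith)

end BoundaryProd

/-! ### Branching, visibility and ideal triangles -/

section Conditions

variable {X : Type u} [MetricSpace X]

/-- Every point of the boundary is separated from another one at every large scale. -/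
def BranchesUniformly (w : X) : Prop :=
  ∃ C t₀ : ℝ, 0 ≤ C ∧ 0 ≤ t₀ ∧ ∀ x : ℕ → X, IsGromovSeq x → ∀ t, t₀ ≤ t →
    ∃ z : ℕ → X, IsGromovSeq z ∧
      ∀ᶠ n in (Filter.hyperfilter ℕ : Filter ℕ), |gromovProd w (x n) (z n) - t| ≤ C

/-- Every point is near a ray from `w` to the boundary. -/
def IsVisual (w : X) : Prop :=
  ∃ V : ℝ, 0 ≤ V ∧ ∀ p : X, ∃ x : ℕ → X, IsGromovSeq x ∧
    ∀ᶠ n in (Filter.hyperfilter ℕ : Filter ℕ), dist p w - V ≤ gromovProd w p (x n)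

variable (X) in
/-- Every point is near the centre of an ideal triangle. -/
def IsCenteredByTriples : Prop :=
  ∃ C : ℝ, 0 ≤ C ∧ ∀ p : X, ∃ x y z : ℕ → X, IsGromovSeq x ∧ IsGromovSeq y ∧ IsGromovSeq z ∧
    ∀ᶠ n in (Filter.hyperfilter ℕ : Filter ℕ), gromovProd p (x n) (y n) ≤ C ∧
      gromovProd p (y n) (z n) ≤ C ∧ gromovProd p (x n) (z n) ≤ C

variable {δ ε : ℝ} {w : X}

lemma BranchesUniformly.isUniformlyPerfect (hU : BranchesUniformly w) (h : FourPoint X δ)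
    (hε : 0 < ε) (hK : Real.exp (ε * δ) ≤ 2) :
    IsUniformlyPerfect (visualDist (X := X) w ε) := by
  obtain ⟨C, t₀, hC, ht₀, hU⟩ := hU
  have hδ := h.1
  refine ⟨8 * Real.exp (ε * (2 * C + 2 * δ)), ?_, Real.exp (-ε * t₀), Real.exp_pos _, ?_⟩
  · have := Real.one_le_exp (show 0 ≤ ε * (2 * C + 2 * δ) by positivity)
    linarith
  intro ξ r hr hr0
  obtain ⟨s, rfl⟩ : ∃ s, Real.exp (-ε * s) = r := ⟨-Real.log r / ε, by
    rw [show -ε * (-Real.log r / ε) = Real.log r by field_simp, Real.exp_log hr]⟩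
  have hs : t₀ ≤ s := by
    rw [Real.exp_le_exp] at hr0
    nlinarith
  obtain ⟨x, hx⟩ := exists_represents ξ
  -- The shift by `C + 2δ` absorbs the branching error and the loss in passing to the boundary
  -- product, so the new point is certainly within `r`. Below, `log 2 / ε` makes the other
  -- inequality strict; with the factor `4` of the metric comparison it gives the `8` in `S`.
  obtain ⟨z, hz, hzt⟩ := hU x hx.isGromovSeq (s + C + 2 * δ) (by linarith)
  obtain ⟨ζ, hz⟩ := hz.exists_represents
  have h1 : (s : EReal) ≤ boundaryProd w ξ ζ := by
    have := h.le_boundaryProd (c := s + 2 * δ) (w := w) hx hz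
      (hzt.mono fun n hn => by linarith [(abs_le.1 hn).1])
    simpa using this
  have h2 : ¬ ((s + (2 * C + 2 * δ) + Real.log 2 / ε : ℝ) : EReal) ≤
      boundaryProd w ξ ζ := by
    refine not_le.2 (lt_of_le_of_lt (boundaryProd_le (c := s + (2 * C + 2 * δ)) hx hz
      (hzt.mono fun n hn => by linarith [(abs_le.1 hn).2])) ?_)
    rw [EReal.coe_lt_coe_iff]
    have : 0 < Real.log 2 / ε := div_pos (Real.log_pos (by norm_num)) hε
    linarith
  rw [← visualRho_le_exp_iff hε] at h1 h2
  refine ⟨_, ?_, visualDist_le_visualRho.trans h1⟩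
  have h3 := h.visualRho_le_visualDist (w := w) (ξ := ξ) (ζ := ζ) hε hK
  have h4 : Real.exp (-ε * (s + (2 * C + 2 * δ) + Real.log 2 / ε)) =
      Real.exp (-ε * s) / (2 * Real.exp (ε * (2 * C + 2 * δ))) := by
    rw [show -ε * (s + (2 * C + 2 * δ) + Real.log 2 / ε) =
      -ε * s - (Real.log 2 + ε * (2 * C + 2 * δ)) by field_simp; ring, Real.exp_sub, Real.exp_add,
      Real.exp_log (by norm_num)]
  rw [h4] at h2
  have h5 : Real.exp (-ε * s) / (8 * Real.exp (ε * (2 * C + 2 * δ))) =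
      Real.exp (-ε * s) / (2 * Real.exp (ε * (2 * C + 2 * δ))) / 4 := by
    field_simp; norm_num
  rw [h5]
  linarith [not_le.1 h2]

lemma IsUniformlyPerfect.branchesUniformly
    (hp : IsUniformlyPerfect (visualDist (X := X) w ε)) (h : FourPoint X δ)
    (hε : 0 < ε) (hK : Real.exp (ε * δ) ≤ 2) : BranchesUniformly w := by
  obtain ⟨S, hS, r₀, hr₀, hp⟩ := hp
  have hδ := h.1
  have hl4 : 0 < Real.log 4 / ε := div_pos (Real.log_pos (by norm_num)) hε
  have hlS : 0 ≤ Real.log S / ε := div_nonneg (Real.log_nonneg hS) hε.le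
  refine ⟨Real.log 4 / ε + 1 + Real.log S / ε + 2 * δ, max 0 (-Real.log r₀ / ε), by positivity,
    le_max_left _ _, fun x hx t ht => ?_⟩
  have htr : Real.exp (-ε * t) ≤ r₀ := by
    rw [← Real.le_log_iff_exp_le hr₀]
    have := (le_max_right _ _).trans ht
    rw [div_le_iff₀ hε] at this
    linarith
  obtain ⟨ξ, hx⟩ := hx.exists_represents
  obtain ⟨ζ, h1, h2⟩ := hp ξ _ (Real.exp_pos (-ε * t)) htr
  obtain ⟨z, hz⟩ := exists_represents ζ
  have h3 := h.visualRho_le_visualDist (w := w) (ξ := ξ) (ζ := ζ) hε hK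
  have h4 : visualRho w ε ξ ζ ≤ Real.exp (-ε * (t - Real.log 4 / ε)) := by
    have : Real.exp (-ε * (t - Real.log 4 / ε)) = 4 * Real.exp (-ε * t) := by
      rw [show -ε * (t - Real.log 4 / ε) = Real.log 4 + -ε * t by field_simp; ring, Real.exp_add,
        Real.exp_log (by norm_num)]
    rw [this]; linarith
  have h5 : ¬ visualRho w ε ξ ζ ≤ Real.exp (-ε * (t + Real.log S / ε)) := by
    have : Real.exp (-ε * (t + Real.log S / ε)) = Real.exp (-ε * t) / S := by
      rw [show -ε * (t + Real.log S / ε) = -ε * t - Real.log S by field_simp; ring, Real.exp_sub,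
        Real.exp_log (by linarith)]
    rw [this]
    exact not_le.2 (h1.trans_le visualDist_le_visualRho)
  rw [visualRho_le_exp_iff hε] at h4 h5
  have h6 := Nat.hyperfilter_le_atTop (eventually_le_of_le_boundaryProd hx hz h4
    (c' := t - Real.log 4 / ε - 1) (by linarith))
  have h7 : ∀ᶠ n in (Filter.hyperfilter ℕ : Filter ℕ),
      gromovProd w (x n) (z n) ≤ t + Real.log S / ε + 2 * δ := by
    by_contra hcon
    rw [Ultrafilter.eventually_not.symm] at hcon
    refine h5 ?_
    have := h.le_boundaryProd (c := t + Real.log S / ε + 2 * δ) (w := w) hx hz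
      (hcon.mono fun n hn => (not_le.1 hn).le)
    simpa using this
  refine ⟨z, hz.isGromovSeq, ?_⟩
  filter_upwards [h6, h7] with n hn6 hn7
  rw [abs_le]
  constructor <;> linarith

/-- For a pole in `X`, moving the base point from `o` to `w` costs a bounded amount. For a pole at
infinity, a line passes near `p` and at most one of its two ends points back to `w`; the other one
serves. -/
lemma HasPole.isVisual (hP : HasPole X) (h : FourPoint X δ) (w : X) : IsVisual w := by
  obtain ⟨L, hL, o, hP⟩ := hP
  have hδ := h.1
  have hnear : ∀ {p : X} {σ : Set X}, σ.Nonempty → Metric.infDist p σ ≤ L →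
      ∃ q ∈ σ, dist p q ≤ L + 1 := by
    intro p σ hσ hp
    obtain ⟨q, hq, hd⟩ := (Metric.infDist_lt_iff hσ).1 (lt_of_le_of_lt hp (lt_add_one L))
    exact ⟨q, hq, hd.le⟩
  rcases o with o | o
  · refine ⟨2 * (L + 1) + 2 * dist o w, by positivity, fun p => ?_⟩
    obtain ⟨η, _, ⟨γ, hγ, rfl, h0, hη⟩, hd⟩ := hP p
    obtain ⟨_, ⟨s, hs, rfl⟩, hps⟩ := hnear (σ := γ '' Set.Ici 0) ⟨γ 0, 0, Set.self_mem_Ici, rfl⟩ hd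
    have hs : 0 ≤ s := hs
    refine ⟨_, hη.isGromovSeq, ?_⟩
    filter_upwards [eventually_hyperfilter_ge ⌈s⌉₊] with n hn
    have hn : s ≤ n := (Nat.le_ceil s).trans (by exact_mod_cast hn)
    have e1 := hγ s hs n (hs.trans hn)
    have e2 := hγ 0 Set.self_mem_Ici n (hs.trans hn)
    have e3 := hγ 0 Set.self_mem_Ici s hs
    rw [abs_of_nonpos (by linarith)] at e1 e2 e3
    rw [h0] at e2 e3
    have t1 := gromovProd_left_le o (γ s) (γ n) p
    have t2 := gromovProd_base_le o w p (γ n)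
    have t3 : gromovProd o (γ s) (γ n) = s := by
      rw [gromovProd, dist_comm _ o, dist_comm _ o, e1, e2, e3]; ring
    have t4 := dist_triangle4 p (γ s) o w
    linarith [dist_comm (γ s) o, dist_comm (γ s) p, dist_comm w o]
  · refine ⟨L + 1 + 2 * δ, by positivity, fun p => ?_⟩
    obtain ⟨η, _, ⟨γ, hγ, rfl, hη', hη⟩, hd⟩ := hP p
    obtain ⟨_, ⟨s, rfl⟩, hps⟩ := hnear (σ := Set.range γ) ⟨γ 0, 0, rfl⟩ hd
    have hor : ∀ᶠ n : ℕ in (Filter.hyperfilter ℕ : Filter ℕ),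
        gromovProd p (γ n) w ≤ L + 1 + δ ∨ gromovProd p (γ (-n)) w ≤ L + 1 + δ := by
      filter_upwards [eventually_hyperfilter_ge ⌈|s|⌉₊] with n hn
      have hn : |s| ≤ n := (Nat.le_ceil _).trans (by exact_mod_cast hn)
      obtain ⟨hn1, hn2⟩ := abs_le.1 hn
      refine h.le_or_le w ?_
      have := isGeodesicOn_gromovProd_eq_zero hγ (Set.mem_univ _) (Set.mem_univ s)
        (Set.mem_univ _) hn1 hn2
      rw [gromovProd_comm] at this
      have t := gromovProd_base_le p (γ s) (γ n) (γ (-n))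
      linarith [dist_comm p (γ s)]
    have key : ∀ x : ℕ → X, (∀ᶠ n : ℕ in (Filter.hyperfilter ℕ : Filter ℕ),
        gromovProd p (x n) w ≤ L + 1 + δ) → ∀ᶠ n in (Filter.hyperfilter ℕ : Filter ℕ),
        dist p w - (L + 1 + 2 * δ) ≤ gromovProd w p (x n) := fun x hx => hx.mono fun n hn => by
      have := gromovProd_add w p (x n)
      rw [gromovProd_comm p] at this
      linarith
    rcases Ultrafilter.eventually_or.1 hor with ho | ho
    · exact ⟨_, hη.isGromovSeq, key _ ho⟩
    · exact ⟨_, hη'.isGromovSeq, key _ ho⟩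

lemma BranchesUniformly.isCenteredByTriples (hU : BranchesUniformly w) (hV : IsVisual w)
    (h : FourPoint X δ) : IsCenteredByTriples X := by
  obtain ⟨C, t₀, hC, ht₀, hU⟩ := hU
  obtain ⟨V, hV0, hV⟩ := hV
  have hδ := h.1
  set M := 2 * C + 2 * δ + 1 with hM
  refine ⟨2 * V + 4 * M + t₀, by positivity, fun p => ?_⟩
  obtain ⟨x, hx, hpx⟩ := hV p
  -- Branching takes place at the heights `t` and `t - M`, both at least `t₀` even when `p` is near
  -- `w`. The gap `M > 2C + 2δ` exceeds the errors, so the two new directions `y` and `z` also part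
  -- near height `t - M`.
  set t := max (dist p w) (t₀ + M) with ht
  have ht1 : dist p w ≤ t := le_max_left _ _
  have ht2 : t₀ + M ≤ t := le_max_right _ _
  have ht3 : t ≤ dist p w + t₀ + M := max_le (by linarith) (by linarith [@dist_nonneg _ _ p w])
  obtain ⟨y, hy, hxy⟩ := hU x hx t (by linarith)
  obtain ⟨z, hz, hxz⟩ := hU x hx (t - M) (by linarith)
  refine ⟨x, y, z, hx, hy, hz, ?_⟩
  filter_upwards [hpx, hxy, hxz] with n h1 h2 h3
  obtain ⟨h2, h2'⟩ := abs_le.1 h2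
  obtain ⟨h3, h3'⟩ := abs_le.1 h3
  have e1 := gromovProd_change_base p w (x n) (y n)
  have e2 := gromovProd_change_base p w (y n) (z n)
  have e3 := gromovProd_change_base p w (x n) (z n)
  have py : dist p w - V - δ - M - C ≤ gromovProd w p (y n) := by
    rcases h.2 w p (x n) (y n) with h4 | h4 <;> linarith
  have pz : dist p w - V - δ - M - C ≤ gromovProd w p (z n) := by
    rcases h.2 w p (x n) (z n) with h4 | h4 <;> linarith
  have yz : gromovProd w (y n) (z n) ≤ t - M + C + δ := by
    rcases h.2 w (x n) (y n) (z n) with h4 | h4 <;> linarith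
  refine ⟨?_, ?_, ?_⟩ <;> linarith

end Conditions

/-! ### Ideal triangles give richness and rigidity -/

section Rich

variable {X : Type u} [MetricSpace X] {δ : ℝ}

/-- A geodesic line as a limit of geodesics joining the terms of two diverging sequences. -/
lemma FourPoint.exists_line [ProperSpace X] (h : FourPoint X δ) (hg : IsGeodesicSpace X)
    {C : ℝ} {p q : X} {x y : ℕ → X} (hx : IsGromovSeq x) (hy : IsGromovSeq y)
    (hC : ∀ᶠ n in (Filter.hyperfilter ℕ : Filter ℕ), gromovProd p (x n) (y n) ≤ C ∧
      gromovProd p (x n) q ≤ C ∧ gromovProd p (y n) q ≤ C) :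
    ∃ γ : ℝ → X, IsGeodesicOn γ Set.univ ∧ dist p (γ 0) ≤ C + 2 * δ ∧
      ∀ s, gromovProd p (γ s) q ≤ 3 * C + 5 * δ := by
  have hδ := h.1
  choose g g1 g2 g3 using fun n => hg.exists_path (x n) (y n)
  set a : ℕ → ℝ := fun n => gromovProd (x n) p (y n) with ha
  have hmem : ∀ n, a n ∈ Set.Icc 0 (dist (x n) (y n)) := fun n =>
    (h.dist_path_le (g1 n) (g2 n) (g3 n) p).1
  have hnear : ∀ n, dist p (g n (a n)) ≤ gromovProd p (x n) (y n) + 2 * δ := fun n =>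
    (h.dist_path_le (g1 n) (g2 n) (g3 n) p).2
  have hlong : ∀ A : ℝ, ∀ᶠ n in (Filter.hyperfilter ℕ : Filter ℕ),
      ∀ s : ℝ, |s| ≤ A → a n + s ∈ Set.Icc 0 (dist (x n) (y n)) := by
    intro A
    obtain ⟨N, hN⟩ := hx.asymptotic_self.eventually_le_dist p (A + C)
    obtain ⟨M, hM⟩ := hy.asymptotic_self.eventually_le_dist p (A + C)
    filter_upwards [hC, eventually_hyperfilter_ge N, eventually_hyperfilter_ge M] with n hn hnN hnM
    intro s hs
    obtain ⟨hs1, hs2⟩ := abs_le.1 hs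
    have e1 := gromovProd_add p (x n) (y n)
    have e2 := hN n hnN
    have e3 := hM n hnM
    have e4 : a n = (dist p (x n) + dist (x n) (y n) - dist p (y n)) / 2 := by
      simp only [ha, gromovProd, dist_comm (y n) (x n)]
    have e5 : a n = gromovProd (x n) p (y n) := rfl
    have e6 := hn.1
    constructor
    · linarith
    · simp only [gromovProd] at e6
      linarith [dist_comm p (x n), dist_comm p (y n)]
  -- The geodesics are recentred at their points near `p`. The clamping is invisible for almost
  -- every `n`, since both end points run off to infinity; properness then gives limits along the
  -- ultrafilter.
  set G : ℝ → ℕ → X := fun s n => g n (max 0 (min (a n + s) (dist (x n) (y n)))) with hG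
  have hGev : ∀ s, ∀ᶠ n in (Filter.hyperfilter ℕ : Filter ℕ),
      a n + s ∈ Set.Icc 0 (dist (x n) (y n)) ∧ G s n = g n (a n + s) := by
    intro s
    filter_upwards [hlong |s|] with n hn
    have := hn s le_rfl
    exact ⟨this, by simp only [hG]; rw [min_eq_left this.2, max_eq_right this.1]⟩
  have hlim : ∀ s, ∃ l, Filter.Tendsto (G s) (Filter.hyperfilter ℕ : Filter ℕ) (nhds l) := by
    intro s
    have hball : ∀ᶠ n in (Filter.hyperfilter ℕ : Filter ℕ),
        G s n ∈ Metric.closedBall p (C + 2 * δ + |s|) := by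
      filter_upwards [hGev s, hC] with n hn hCn
      rw [hn.2, Metric.mem_closedBall]
      have e1 := g1 n _ hn.1 _ (hmem n)
      rw [add_sub_cancel_left] at e1
      have e2 := dist_triangle_right (g n (a n + s)) p (g n (a n))
      linarith [hnear n, hCn.1]
    obtain ⟨l, -, hl⟩ := (isCompact_closedBall p (C + 2 * δ + |s|)).ultrafilter_le_nhds
      ((Filter.hyperfilter ℕ).map (G s)) (Filter.le_principal_iff.2 hball)
    exact ⟨l, hl⟩
  choose γ hγ using hlim
  refine ⟨γ, ?_, ?_, ?_⟩
  · intro s _ t _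
    refine tendsto_nhds_unique ((hγ s).dist (hγ t)) (Filter.Tendsto.congr' ?_ tendsto_const_nhds)
    filter_upwards [hGev s, hGev t] with n hs ht
    rw [hs.2, ht.2, g1 n _ hs.1 _ ht.1]
    congr 1; ring
  · refine le_of_tendsto (tendsto_const_nhds.dist (hγ 0)) ?_
    filter_upwards [hGev 0, hC] with n hn hCn
    rw [hn.2, add_zero]
    linarith [hnear n, hCn.1]
  · intro s
    have hcont : Filter.Tendsto (fun n => gromovProd p (G s n) q)
        (Filter.hyperfilter ℕ : Filter ℕ) (nhds (gromovProd p (γ s) q)) :=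
      ((((hγ s).dist tendsto_const_nhds).add tendsto_const_nhds).sub
        ((hγ s).dist tendsto_const_nhds)).div_const 2
    refine le_of_tendsto hcont ?_
    filter_upwards [hGev s, hC] with n hn hCn
    rw [hn.2]
    have hu := hnear n
    -- Here `z` is the end of the geodesic beyond the parameter `a n + s`. Either that point
    -- inherits the small product with `q` from `z`, or its product with `z` is small, and then it
    -- is itself near `p`.
    have main : ∀ z : X, gromovProd (g n (a n)) z (g n (a n + s)) =
        dist (g n (a n + s)) (g n (a n)) → gromovProd p z q ≤ C →
        gromovProd p (g n (a n + s)) q ≤ 3 * C + 5 * δ := by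
      intro z hz hzq
      have b1 := gromovProd_base_le (g n (a n)) p z (g n (a n + s))
      have b2 := dist_triangle_right (g n (a n + s)) p (g n (a n))
      have b3 := gromovProd_le_left p (g n (a n + s)) q
      have b4 := gromovProd_nonneg p z q
      rcases h.2 p z (g n (a n + s)) q with h4 | h4 <;> linarith [hCn.1]
    rcases le_total 0 s with hs | hs
    · refine main (y n) ?_ hCn.2.2
      have := isGeodesicOn_gromovProd_eq_zero (g1 n) (hmem n) hn.1
        ⟨dist_nonneg, le_rfl⟩ (by linarith) hn.1.2
      rw [g3] at this
      have e := gromovProd_add (g n (a n)) (g n (a n + s)) (y n)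
      rw [gromovProd_comm]; linarith
    · refine main (x n) ?_ hCn.2.1
      have := isGeodesicOn_gromovProd_eq_zero (g1 n) ⟨le_rfl, dist_nonneg⟩ hn.1 (hmem n)
        hn.1.1 (by linarith)
      rw [g2, gromovProd_comm] at this
      have e := gromovProd_add (g n (a n)) (g n (a n + s)) (x n)
      rw [gromovProd_comm]; linarith

/-- At most one end of an ideal triangle centred at `p` points towards `q`; the line joins two
others. -/
lemma IsCenteredByTriples.exists_line [ProperSpace X] (hT : IsCenteredByTriples X)
    (h : FourPoint X δ) (hg : IsGeodesicSpace X) :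
    ∃ C : ℝ, 0 ≤ C ∧ ∀ p q : X, ∃ γ : ℝ → X, IsGeodesicOn γ Set.univ ∧ dist p (γ 0) ≤ C ∧
      ∀ s, gromovProd p (γ s) q ≤ C := by
  obtain ⟨C, hC, hT⟩ := hT
  have hδ := h.1
  refine ⟨3 * C + 8 * δ, by positivity, fun p q => ?_⟩
  obtain ⟨x, y, z, hx, hy, hz, hev⟩ := hT p
  have key : ∀ x y : ℕ → X, IsGromovSeq x → IsGromovSeq y →
      (∀ᶠ n in (Filter.hyperfilter ℕ : Filter ℕ), gromovProd p (x n) (y n) ≤ C + δ ∧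
        gromovProd p (x n) q ≤ C + δ ∧ gromovProd p (y n) q ≤ C + δ) →
      ∃ γ : ℝ → X, IsGeodesicOn γ Set.univ ∧ dist p (γ 0) ≤ 3 * C + 8 * δ ∧
      ∀ s, gromovProd p (γ s) q ≤ 3 * C + 8 * δ := by
    intro x y hx hy hev
    obtain ⟨γ, h1, h2, h3⟩ := h.exists_line hg hx hy hev
    exact ⟨γ, h1, by linarith, fun s => by linarith [h3 s]⟩
  have hor : ∀ᶠ n in (Filter.hyperfilter ℕ : Filter ℕ),
      (gromovProd p (x n) q ≤ C + δ ∧ gromovProd p (y n) q ≤ C + δ) ∨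
      (gromovProd p (y n) q ≤ C + δ ∧ gromovProd p (z n) q ≤ C + δ) ∨
      (gromovProd p (x n) q ≤ C + δ ∧ gromovProd p (z n) q ≤ C + δ) := by
    filter_upwards [hev] with n hn
    have h1 := h.le_or_le q hn.1
    have h2 := h.le_or_le q hn.2.1
    have h3 := h.le_or_le q hn.2.2
    tauto
  rcases Ultrafilter.eventually_or.1 hor with ho | ho
  · exact key x y hx hy ((ho.and hev).mono fun n hn => ⟨by linarith [hn.2.1], hn.1⟩)
  rcases Ultrafilter.eventually_or.1 ho with ho | ho
  · exact key y z hy hz ((ho.and hev).mono fun n hn => ⟨by linarith [hn.2.2.1], hn.1⟩)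
  · exact key x z hx hz ((ho.and hev).mono fun n hn => ⟨by linarith [hn.2.2.2], hn.1⟩)

lemma IsGeodesicOn.isGeodesicSegment {γ : ℝ → X} (h : IsGeodesicOn γ Set.univ) (s t : ℝ) :
    ∃ σ, IsGeodesicSegment σ (γ s) (γ t) ∧ σ ⊆ Set.range γ := by
  have hd := h s (Set.mem_univ _) t (Set.mem_univ _)
  rcases le_total s t with hst | hst
  · rw [abs_of_nonpos (by linarith)] at hd
    refine ⟨_, ⟨fun r => γ (s + r), fun a _ b _ => ?_, by simp,
      by rw [hd]; exact congrArg γ (by ring), rfl⟩, ?_⟩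
    · rw [h _ (Set.mem_univ _) _ (Set.mem_univ _)]; congr 1; ring
    · rintro _ ⟨r, _, rfl⟩; exact ⟨_, rfl⟩
  · rw [abs_of_nonneg (by linarith)] at hd
    refine ⟨_, ⟨fun r => γ (s - r), fun a _ b _ => ?_, by simp,
      by rw [hd]; exact congrArg γ (by ring), rfl⟩, ?_⟩
    · rw [h _ (Set.mem_univ _) _ (Set.mem_univ _), abs_sub_comm]; congr 1; ring
    · rintro _ ⟨r, _, rfl⟩; exact ⟨_, rfl⟩

lemma FourPoint.gromovProd_le_of_nearest_line {e : ℝ} (h : FourPoint X δ) {γ : ℝ → X}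
    (hγ : IsGeodesicOn γ Set.univ) {p : X} {s : ℝ} (hs : ∀ t, dist p (γ s) ≤ dist p (γ t) + e)
    (t : ℝ) : gromovProd (γ s) p (γ t) ≤ e + 2 * δ := by
  obtain ⟨σ, hσ, hsub⟩ := hγ.isGeodesicSegment s t
  refine h.gromovProd_le_of_nearest hσ fun z hz => ?_
  obtain ⟨r, rfl⟩ := hsub hz
  exact hs r

lemma IsCenteredByTriples.isGeodesicallyRich [ProperSpace X] (hT : IsCenteredByTriples X)
    (h : FourPoint X δ) (hg : IsGeodesicSpace X) : IsGeodesicallyRich X := by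
  have hδ := h.1
  obtain ⟨C, hC, hl⟩ := hT.exists_line h hg
  refine ⟨hg, 0, C + 1, 2 * C + 1, C + 1, 3 * C + 9 * δ + 4, fun p q _ => ?_, ?_⟩
  · obtain ⟨γ, hγ, h0, hq⟩ := hl p q
    refine ⟨_, ⟨γ, hγ, rfl⟩, ?_, ?_⟩
    · linarith [Metric.infDist_le_dist_of_mem (x := p) (Set.mem_range_self (f := γ) 0)]
    · have h1 := Metric.infDist_le_dist_of_mem (x := q) (Set.mem_range_self (f := γ) 0)
      have h2 : dist p q - 2 * C ≤ Metric.infDist q (Set.range γ) := by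
        rw [Metric.le_infDist (Set.range_nonempty γ)]
        rintro _ ⟨s, rfl⟩
        have e := dist_eq_gromovProd p (γ s) q
        have := hq s
        have := @dist_nonneg _ _ (γ s) p
        linarith [dist_comm q (γ s), dist_comm q p]
      have t := dist_triangle q p (γ 0)
      rw [abs_lt]
      constructor <;> linarith [dist_comm q p]
  · rintro _ p ⟨g, hg', rfl⟩
    obtain ⟨_, ⟨r, rfl⟩, hr⟩ := (Metric.infDist_lt_iff (Set.range_nonempty g)).1
      (lt_add_one (Metric.infDist p (Set.range g)))
    have hnear : ∀ t, dist p (g r) ≤ dist p (g t) + 1 := fun t => by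
      linarith [Metric.infDist_le_dist_of_mem (x := p) (Set.mem_range_self (f := g) t)]
    have hle := Metric.infDist_le_dist_of_mem (x := p) (Set.mem_range_self (f := g) r)
    -- The new line avoids the direction of the near-projection `g r` of `p`. A path from it to `g`
    -- must then essentially run through `p` and `g r`, or else `p` is already close to `g`.
    obtain ⟨γ, hγ, h0, hq⟩ := hl p (g r)
    refine ⟨_, ⟨γ, hγ, rfl⟩, ?_, ?_⟩
    · linarith [Metric.infDist_le_dist_of_mem (x := p) (Set.mem_range_self (f := γ) 0)]
    · have h1 : setDist (Set.range γ) (Set.range g) ≤ dist (γ 0) (g r) := by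
        refine csInf_le ⟨0, ?_⟩ ⟨_, ⟨0, rfl⟩, _, ⟨r, rfl⟩, rfl⟩
        rintro _ ⟨_, _, _, _, rfl⟩
        exact dist_nonneg
      have h2 : Metric.infDist p (Set.range g) - (3 * C + 9 * δ + 3) ≤
          setDist (Set.range γ) (Set.range g) := by
        refine le_csInf ⟨_, _, ⟨0, rfl⟩, _, ⟨r, rfl⟩, rfl⟩ ?_
        rintro _ ⟨_, ⟨s, rfl⟩, _, ⟨t, rfl⟩, rfl⟩
        have e1 := h.gromovProd_le_of_nearest_line hg' hnear t
        have e2 := gromovProd_add p (g r) (γ s)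
        rw [gromovProd_comm p] at e2
        have e3 := hq s
        have e4 := dist_eq_gromovProd p (γ s) (g r)
        have e5 := dist_eq_gromovProd (g r) (γ s) (g t)
        have := @dist_nonneg _ _ (γ s) p
        have := @dist_nonneg _ _ (γ s) (g t)
        have := @dist_nonneg _ _ (g t) (g r)
        rcases h.2 (g r) p (γ s) (g t) with h4 | h4 <;>
        linarith [dist_comm (g r) p]
      have t := dist_triangle_left (γ 0) (g r) p
      rw [abs_lt]
      constructor <;> linarith

/-- Both `p` and `f p` are centres of `f (x n)`, `f (y n)`, `f (z n)` for a suitable `n`: `f p`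
because quasi-isometries preserve small products, `p` because `f (x n)` and `x n` converge to the
same boundary point, and likewise for `y` and `z`. -/
lemma IsCenteredByTriples.isBoundaryRigid (hT : IsCenteredByTriples X)
    (h : FourPoint X δ) (hg : IsGeodesicSpace X) : IsBoundaryRigid X := by
  obtain ⟨C, hC, hT⟩ := hT
  have hδ := h.1
  intro K A f hf hid
  obtain ⟨D, hD, hfD⟩ := hf.1.exists_gromovProd_le hg h hg h C
  refine ⟨3 * (C + D + 2 * δ) + 2 * δ, fun p => ?_⟩
  obtain ⟨x, y, z, hx, hy, hz, hev⟩ := hT p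
  have hbig : ∀ x : ℕ → X, IsGromovSeq x → ∀ᶠ n in (Filter.hyperfilter ℕ : Filter ℕ),
      C + 2 * δ + 1 ≤ gromovProd p (f (x n)) (x n) := fun x hx => by
    obtain ⟨ξ, hξ⟩ := hx.exists_represents
    have := ((hid x ξ hξ).asymptotic h hξ).tendsto p
    exact Nat.hyperfilter_le_atTop (Filter.tendsto_atTop.1 this (C + 2 * δ + 1))
  have hsmall : ∀ a b : X, gromovProd p a b ≤ C → C + 2 * δ + 1 ≤ gromovProd p (f a) a →
      C + 2 * δ + 1 ≤ gromovProd p (f b) b →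
      gromovProd p (f a) (f b) ≤ C + D + 2 * δ := by
    intro a b h1 h2 h3
    rw [gromovProd_comm] at h2
    rcases h.chain p a (f a) (f b) b with h4 | h4 | h4 <;> linarith
  obtain ⟨n, ⟨h1, h2, h3⟩, hxn, hyn, hzn⟩ :=
    (hev.and ((hbig x hx).and ((hbig y hy).and (hbig z hz)))).exists
  have hD' : ∀ a b : X, gromovProd p a b ≤ C → gromovProd (f p) (f a) (f b) ≤ C + D + 2 * δ :=
    fun a b hab => by linarith [hfD a b p hab]
  exact h.dist_center_le (hsmall _ _ h1 hxn hyn) (hsmall _ _ h2 hyn hzn) (hsmall _ _ h3 hxn hzn)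
    (hD' _ _ h1) (hD' _ _ h2) (hD' _ _ h3)

end Rich

/-! ### Transport to a larger universe -/

section Lift

variable {X : Type u} [MetricSpace X]

lemma dist_ulift (x y : ULift.{v} X) : dist x y = dist x.down y.down := rfl

lemma isGeodesicSegment_image_down {σ : Set (ULift.{v} X)} {x y : ULift.{v} X}
    (h : IsGeodesicSegment σ x y) : IsGeodesicSegment (ULift.down '' σ) x.down y.down := by
  obtain ⟨γ, h1, h2, h3, rfl⟩ := h
  refine ⟨fun s => (γ s).down, fun s hs t ht => h1 s hs t ht, congrArg ULift.down h2, congrArg ULift.down h3, ?_⟩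
  rw [Set.image_image]; rfl

lemma infDist_image_up (p : X) (σ : Set X) :
    Metric.infDist (ULift.up.{v} p) (ULift.up '' σ) = Metric.infDist p σ :=
  Metric.infDist_image (Φ := (ULift.up : X → ULift.{v} X)) (Isometry.of_dist_eq fun _ _ => rfl)

lemma IsDeltaHyperbolic.ulift {δ : ℝ} (h : IsDeltaHyperbolic X δ) :
    IsDeltaHyperbolic (ULift.{v} X) δ := by
  refine ⟨h.1, fun x y z a b c ha hb hc p hp => ?_⟩
  obtain ⟨q, hq, hpq⟩ := h.2 _ _ _ _ _ _ (isGeodesicSegment_image_down ha)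
    (isGeodesicSegment_image_down hb) (isGeodesicSegment_image_down hc) p.down ⟨p, hp, rfl⟩
  rw [← Set.image_union] at hq
  obtain ⟨r, hr, rfl⟩ := hq
  exact ⟨r, hr, hpq⟩

lemma IsGeodesicSpace.ulift (h : IsGeodesicSpace X) : IsGeodesicSpace (ULift.{v} X) := by
  intro x y
  obtain ⟨γ, h1, h2, h3⟩ := h.exists_path x.down y.down
  exact ⟨_, fun s => ULift.up (γ s), fun s hs t ht => h1 s hs t ht, congrArg ULift.up h2,
    congrArg ULift.up h3, rfl⟩

lemma setDist_image_up (σ τ : Set X) :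
    setDist (ULift.up.{v} '' σ) (ULift.up.{v} '' τ) = setDist σ τ := by
  simp only [setDist, Set.image2_image_left, Set.image2_image_right]; rfl

lemma isGeodesicLine_image_up {σ : Set X} (h : IsGeodesicLine σ) :
    IsGeodesicLine (ULift.up.{v} '' σ) := by
  obtain ⟨γ, h1, rfl⟩ := h
  exact ⟨fun s => ULift.up (γ s), fun s hs t ht => h1 s hs t ht, by rw [← Set.range_comp]; rfl⟩

lemma isGeodesicLine_image_down {σ : Set (ULift.{v} X)} (h : IsGeodesicLine σ) :
    ∃ τ : Set X, IsGeodesicLine τ ∧ σ = ULift.up '' τ := by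
  obtain ⟨γ, h1, rfl⟩ := h
  exact ⟨_, ⟨fun s => (γ s).down, fun s hs t ht => h1 s hs t ht, rfl⟩,
    by rw [← Set.range_comp]; rfl⟩

lemma IsGeodesicallyRich.ulift (h : IsGeodesicallyRich X) :
    IsGeodesicallyRich (ULift.{v} X) := by
  obtain ⟨hg, r₀, r₁, r₂, r₃, r₄, h1, h2⟩ := h
  refine ⟨hg.ulift, r₀, r₁, r₂, r₃, r₄, ?_, ?_⟩
  · rintro ⟨p⟩ ⟨q⟩ hpq
    obtain ⟨σ, hσ, a, b⟩ := h1 p q hpq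
    refine ⟨_, isGeodesicLine_image_up hσ, ?_, ?_⟩
    · rwa [infDist_image_up]
    · rwa [infDist_image_up]
  · rintro σ' ⟨p⟩ hσ'
    obtain ⟨σ, hσ, rfl⟩ := isGeodesicLine_image_down hσ'
    obtain ⟨τ, hτ, a, b⟩ := h2 σ p hσ
    refine ⟨_, isGeodesicLine_image_up hτ, ?_, ?_⟩
    · rwa [infDist_image_up]
    · rwa [infDist_image_up, setDist_image_up]

lemma isGromovSeq_up {x : ℕ → X} (h : IsGromovSeq x) :
    IsGromovSeq (fun n => (ULift.up (x n) : ULift.{v} X)) := fun w => h w.down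

lemma isGromovSeq_down {x : ℕ → ULift.{v} X} (h : IsGromovSeq x) :
    IsGromovSeq (fun n => (x n).down) := fun w => h (ULift.up w)

/-- The witness is `X` itself; `ULift` only moves it to the universe where `Y` must live. -/
lemma IsGeodesicallyRich.embedsInRichSpace (h : IsGeodesicallyRich X) {δ : ℝ}
    (hδ : IsDeltaHyperbolic X δ) : EmbedsInRichSpace.{u, v} X := by
  refine ⟨ULift.{v} X, inferInstance, h.ulift, ⟨δ, hδ.ulift⟩, 1, 0, ULift.up,
    Quot.map (fun x => ⟨_, isGromovSeq_up x.2⟩) (fun x y hxy w => hxy w.down),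
    ⟨le_rfl, le_rfl, fun x y => by simp [dist_ulift]⟩, ?_, ?_⟩
  · rintro x _ ⟨hx, rfl⟩
    exact ⟨isGromovSeq_up hx, rfl⟩
  · refine Function.bijective_iff_has_inverse.2
      ⟨Quot.map (fun x => ⟨_, isGromovSeq_down x.2⟩) (fun x y hxy w => hxy (ULift.up w)), ?_, ?_⟩
    · rintro ⟨x⟩; rfl
    · rintro ⟨x⟩; rfl

end Lift

/-! ### Branching from an embedding in a rich space -/

section Embedding

variable {X : Type u} {Y : Type v} [MetricSpace X] [MetricSpace Y] {δ δ' : ℝ}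

lemma IsGeodesicOn.dist_zero {γ : ℝ → X} {A s : ℝ} (h : IsGeodesicOn γ (Set.Icc 0 A))
    (hs : s ∈ Set.Icc 0 A) : dist (γ s) (γ 0) = s := by
  rw [h s hs 0 ⟨le_rfl, hs.1.trans hs.2⟩, sub_zero, abs_of_nonneg hs.1]

/-- A long geodesic from `w` towards a point of the boundary. -/
lemma FourPoint.exists_path_toward (h : FourPoint X δ) (hg : IsGeodesicSpace X) {x : ℕ → X}
    (hx : IsGromovSeq x) (w : X) (A : ℝ) :
    ∃ (γ : ℝ → X) (N : ℕ), IsGeodesicOn γ (Set.Icc 0 A) ∧ γ 0 = w ∧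
      ∀ n, N ≤ n → ∀ s ∈ Set.Icc 0 A, s - δ ≤ gromovProd w (γ s) (x n) := by
  obtain ⟨N, hN⟩ := hx.asymptotic_self w A
  obtain ⟨γ, h1, h2, h3⟩ := hg.exists_path w (x N)
  have hAN : A ≤ dist w (x N) := by
    rw [dist_comm]
    exact (hN N N le_rfl le_rfl).trans (gromovProd_le_left _ _ _)
  refine ⟨γ, N, h1.mono (Set.Icc_subset_Icc_right hAN), h2, fun n hn s hs => ?_⟩
  have hs' : s ∈ Set.Icc 0 (dist w (x N)) := ⟨hs.1, hs.2.trans hAN⟩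
  have e1 := h1.dist_zero hs'
  have e2 := isGeodesicOn_gromovProd_eq_zero h1 ⟨le_rfl, dist_nonneg⟩ hs' ⟨dist_nonneg, le_rfl⟩
    hs'.1 hs'.2
  rw [h2, h3] at e2
  rw [h2] at e1
  have e3 := gromovProd_add w (γ s) (x N)
  have e4 := hN N n le_rfl hn
  rcases h.2 w (γ s) (x N) (x n) with h4 | h4 <;> linarith [hs.2]

lemma FourPoint.exists_center (h : FourPoint X δ) (hg : IsGeodesicSpace X) (w x z : X) :
    ∃ c : X, dist c w = gromovProd w x z ∧ gromovProd c w x ≤ δ ∧ gromovProd c w z ≤ δ ∧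
      gromovProd c x z ≤ δ := by
  obtain ⟨γ, h1, h2, h3⟩ := hg.exists_path w x
  have hs : gromovProd w x z ∈ Set.Icc 0 (dist w x) :=
    ⟨gromovProd_nonneg _ _ _, by rw [dist_comm]; exact gromovProd_le_left _ _ _⟩
  have e1 := h1.dist_zero hs
  have e2 := isGeodesicOn_gromovProd_eq_zero h1 ⟨le_rfl, dist_nonneg⟩ hs ⟨dist_nonneg, le_rfl⟩
    hs.1 hs.2
  rw [h2, h3] at e2
  rw [h2] at e1
  set c := γ (gromovProd w x z)
  have hd := h.1
  have e3 := gromovProd_add w c x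
  have e4 := gromovProd_add w c z
  have e5 := gromovProd_change_base c w x z
  have e6 : gromovProd w x z - δ ≤ gromovProd w c z := by
    rcases h.2 w c x z with h4 | h4 <;> linarith
  exact ⟨c, e1, by linarith, by linarith, by linarith⟩

lemma IsGeodesicOn.isGromovSeq {γ : ℝ → X} (h : IsGeodesicOn γ Set.univ) :
    IsGromovSeq (fun n : ℕ => γ n) := by
  rw [isGromovSeq_iff]
  intro w A
  refine ⟨⌈A + dist w (γ 0)⌉₊, fun m n hm hn => ?_⟩
  have hm' : A + dist w (γ 0) ≤ m := (Nat.le_ceil _).trans (by exact_mod_cast hm)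
  have hn' : A + dist w (γ 0) ≤ n := (Nat.le_ceil _).trans (by exact_mod_cast hn)
  have e := gromovProd_base_le (γ 0) w (γ m) (γ n)
  have : A + dist w (γ 0) ≤ gromovProd (γ 0) (γ m) (γ n) := by
    rw [gromovProd, h _ (Set.mem_univ _) _ (Set.mem_univ _), h _ (Set.mem_univ _) _ (Set.mem_univ _),
      h _ (Set.mem_univ _) _ (Set.mem_univ _), sub_zero, sub_zero, abs_of_nonneg (Nat.cast_nonneg _),
      abs_of_nonneg (Nat.cast_nonneg _)]
    rcases le_total (m : ℝ) n with h1 | h1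
    · rw [abs_of_nonpos (by linarith)]; linarith
    · rw [abs_of_nonneg (by linarith)]; linarith
  linarith

lemma IsGeodesicOn.comp_neg {γ : ℝ → X} (h : IsGeodesicOn γ Set.univ) :
    IsGeodesicOn (fun s => γ (-s)) Set.univ := fun s _ t _ => by
  rw [h _ (Set.mem_univ _) _ (Set.mem_univ _), abs_sub_comm]; congr 1; ring

/-- In a geodesically rich space, for `p` far from `w`, there is a geodesic line passing near `p`
and leaving `p` in directions away from `w`. -/
lemma IsGeodesicallyRich.exists_line (hY : IsGeodesicallyRich Y) (h : FourPoint Y δ) :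
    ∃ r₀ E : ℝ, 0 ≤ E ∧ ∀ p w : Y, r₀ ≤ dist p w → ∃ γ : ℝ → Y, IsGeodesicOn γ Set.univ ∧
      dist p (γ 0) ≤ E ∧ ∀ s, gromovProd p w (γ s) ≤ E := by
  obtain ⟨-, r₀, r₁, r₂, -, -, h1, -⟩ := hY
  have hd := h.1
  refine ⟨r₀, |2 * r₁| + |r₂| + 2 * δ, by positivity, fun p w hpw => ?_⟩
  obtain ⟨_, ⟨γ, hγ, rfl⟩, hp, hw⟩ := h1 p w hpw
  obtain ⟨_, ⟨s₀, rfl⟩, hs₀⟩ := (Metric.infDist_lt_iff (Set.range_nonempty γ)).1 hp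
  -- The line passes near `p` and is about as far from `w` as `p` is, so `γ s₀` is nearly its
  -- closest point to `w`.
  have hnear : ∀ t, dist w (γ s₀) ≤ dist w (γ t) + (r₁ + r₂) := fun t => by
    have e1 := Metric.infDist_le_dist_of_mem (x := w) (Set.mem_range_self (f := γ) t)
    have e2 := (abs_lt.1 hw).1
    have e3 := dist_triangle w p (γ s₀)
    linarith [dist_comm w p]
  have a1 := le_abs_self (2 * r₁)
  have a2 := le_abs_self r₂
  have hr1 : 0 < r₁ := lt_of_le_of_lt dist_nonneg hs₀
  refine ⟨fun s => γ (s₀ + s), fun s _ t _ => ?_, ?_, fun s => ?_⟩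
  · rw [hγ _ (Set.mem_univ _) _ (Set.mem_univ _)]; congr 1; ring
  · change dist p (γ (s₀ + 0)) ≤ _
    rw [add_zero]; linarith [abs_nonneg r₂]
  · have e1 := h.gromovProd_le_of_nearest_line hγ hnear (s₀ + s)
    have e2 := gromovProd_base_le p (γ s₀) w (γ (s₀ + s))
    linarith [dist_comm p (γ s₀)]

/-- The centre `c` of `w`, `x n`, `z n` lies at height `(x n|z n)_w`. With `z` pulled back from a
suitable end of the line, both `f c` and `f p` are centres of the image triple, so `c` is near `p`,
whose height is `t`. -/
lemma IsQIEmbedding.branchesUniformly {K C : ℝ} {f : X → Y}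
    {F : GromovBoundary X → GromovBoundary Y} (hf : IsQIEmbedding K C f)
    (hF : InducesBoundaryMap f F) (hsurj : Function.Surjective F) (hX : FourPoint X δ)
    (hgX : IsGeodesicSpace X) (hY : FourPoint Y δ') (hrich : IsGeodesicallyRich Y) (w : X) :
    BranchesUniformly w := by
  obtain ⟨D, hD, hfD⟩ := hf.exists_gromovProd_le hgX hX hrich.1 hY δ
  obtain ⟨r₀, E, hE, hline⟩ := hrich.exists_line hY
  obtain ⟨hK, hC, hf⟩ := hf
  have hδ := hX.1
  have hδ' := hY.1
  have hK0 : 0 < K := by linarith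
  refine ⟨K * (3 * (D + E + 2 * δ') + 2 * δ' + C), K * (|r₀| + C), by positivity, by positivity,
    fun x hx t ht => ?_⟩
  have ht0 : 0 ≤ t := le_trans (by positivity) ht
  obtain ⟨g, N, g1, g2, g3⟩ := hX.exists_path_toward hgX hx w t
  set p := g t with hp
  have hpw : dist p w = t := by rw [← g2]; exact g1.dist_zero ⟨ht0, le_rfl⟩
  have hfar : r₀ ≤ dist (f p) (f w) := by
    have e1 := (hf p w).1
    rw [hpw] at e1
    have e2 : |r₀| + C ≤ K⁻¹ * t := by rwa [le_inv_mul_iff₀ hK0]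
    linarith [le_abs_self r₀]
  obtain ⟨γ, hγ, hγ0, hγw⟩ := hline _ _ hfar
  have key : ∀ a : ℕ → Y, IsGromovSeq a → (∀ n, gromovProd (f p) (f w) (a n) ≤ E) →
      (∀ᶠ n in (Filter.hyperfilter ℕ : Filter ℕ), gromovProd (f p) (a n) (f (x n)) ≤ E + δ') →
      ∃ z : ℕ → X, IsGromovSeq z ∧ ∀ᶠ n in (Filter.hyperfilter ℕ : Filter ℕ),
        |gromovProd w (x n) (z n) - t| ≤ K * (3 * (D + E + 2 * δ') + 2 * δ' + C) := by
    intro a ha haw hax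
    obtain ⟨η, hη⟩ := ha.exists_represents
    obtain ⟨ζ, rfl⟩ := hsurj η
    obtain ⟨z, hz⟩ := exists_represents ζ
    have hasy := (hη.asymptotic hY (hF z ζ hz)).tendsto (f p)
    refine ⟨z, hz.isGromovSeq, ?_⟩
    filter_upwards [hax, eventually_hyperfilter_ge N, Nat.hyperfilter_le_atTop
      (Filter.tendsto_atTop.1 hasy (E + 2 * δ' + 1))] with n h1 h2 h3
    have h3 : E + 2 * δ' + 1 ≤ gromovProd (f p) (a n) (f (z n)) := h3
    have b1 : gromovProd (f p) (f w) (f (x n)) ≤ D := by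
      refine hfD _ _ _ ?_
      have e1 := g3 n h2 t ⟨ht0, le_rfl⟩
      have e2 := gromovProd_add w p (x n)
      linarith
    have b2 : gromovProd (f p) (f w) (f (z n)) ≤ E + δ' := by
      have := haw n
      have e := gromovProd_comm (f p) (f (z n)) (a n)
      rcases hY.2 (f p) (f w) (f (z n)) (a n) with h4 | h4 <;> linarith
    have b3 : gromovProd (f p) (f (x n)) (f (z n)) ≤ E + 2 * δ' := by
      rw [gromovProd_comm]
      rcases hY.2 (f p) (a n) (f (z n)) (f (x n)) with h4 | h4 <;> linarith
    obtain ⟨c, c0, c1, c2, c3⟩ := hX.exists_center hgX w (x n) (z n)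
    have d1 := hfD _ _ _ c1
    have d2 := hfD _ _ _ c2
    have d3 := hfD _ _ _ c3
    have hcen := hY.dist_center_le (C := D + E + 2 * δ') (p := f c) (q := f p) (a := f w)
      (b := f (x n)) (c := f (z n)) (by linarith) (by linarith) (by linarith) (by linarith)
      (by linarith) (by linarith)
    have hcp : dist c p ≤ K * (3 * (D + E + 2 * δ') + 2 * δ' + C) := by
      rw [← inv_mul_le_iff₀ hK0]
      linarith [(hf c p).1]
    rw [← c0, ← hpw]
    exact (abs_dist_sub_le c p w).trans hcp
  have hor : ∀ᶠ n : ℕ in (Filter.hyperfilter ℕ : Filter ℕ),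
      gromovProd (f p) (γ n) (f (x n)) ≤ E + δ' ∨
        gromovProd (f p) (γ (-n)) (f (x n)) ≤ E + δ' := by
    refine Filter.Eventually.of_forall fun n => hY.le_or_le _ ?_
    have hn : (0 : ℝ) ≤ n := Nat.cast_nonneg n
    have := isGeodesicOn_gromovProd_eq_zero hγ (r := -n) (s := 0) (t := n) (Set.mem_univ _)
      (Set.mem_univ _) (Set.mem_univ _) (by linarith) hn
    rw [gromovProd_comm] at this
    have e := gromovProd_base_le (f p) (γ 0) (γ n) (γ (-n))
    linarith [dist_comm (f p) (γ 0)]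
  rcases Ultrafilter.eventually_or.1 hor with ho | ho
  · exact key _ hγ.isGromovSeq (fun n => hγw _) ho
  · exact key _ hγ.comp_neg.isGromovSeq (fun n => hγw _) ho

end Embedding

/-! ### Failure of branching gives isolated tubes and a sliding map -/

section Tubes

variable {X : Type u} [MetricSpace X] {δ : ℝ} {w : X} {D : ℝ}

/-- If some boundary point is not separated from the others over a long range of scales, the
points of `X` at these heights split into a tube around a geodesic and points far from it. -/
lemma IsVisual.exists_tube (hV : IsVisual w) (hU : ¬ BranchesUniformly w) (h : FourPoint X δ)
    (hg : IsGeodesicSpace X) : ∃ D : ℝ, 0 ≤ D ∧ ∀ S t₀ : ℝ, 0 ≤ S → 0 ≤ t₀ →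
      ∃ (a : ℝ) (γ : ℝ → X), t₀ ≤ a ∧ IsGeodesicOn γ (Set.Icc 0 (a + S)) ∧ γ 0 = w ∧
        ∀ y, dist y w ∈ Set.Icc a (a + S) → dist y (γ (dist y w)) ≤ D + 2 →
          dist y (γ (dist y w)) ≤ D := by
  obtain ⟨V, hV0, hV⟩ := hV
  have hδ := h.1
  set D := 2 * V + 6 * δ with hD
  refine ⟨D, by positivity, fun S t₀ hS ht₀ => ?_⟩
  set E := D + V + 5 * δ + 2 with hE
  simp only [BranchesUniformly] at hU
  push Not at hU
  -- No `(x|z)_w` falls within `S + E` of `t`. For a boundary direction `z` through `y`, either `z`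
  -- follows `x` well beyond height `t`, which puts `y` within `D`, or it leaves before height `t -
  -- S - E`, too early for `y` to be within `D + 2`.
  obtain ⟨x, hx, t, ht, hxt⟩ := hU (S + E) (t₀ + S + E) (by positivity) (by positivity)
  refine ⟨t - S, ?_⟩
  have hE0 : 0 ≤ E := by positivity
  obtain ⟨γ, N, g1, g2, g3⟩ := h.exists_path_toward hg hx w t
  refine ⟨γ, by linarith, by simpa using g1, g2, fun y hy hyd => ?_⟩
  obtain ⟨z, hz, hyz⟩ := hV y
  obtain ⟨n, hn1, hn2, hn3⟩ := ((hxt z hz).and (hyz.and (eventually_hyperfilter_ge N))).exists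
  set s := dist y w with hs
  have hst : s ∈ Set.Icc 0 t := ⟨dist_nonneg, by linarith [hy.2]⟩
  have e1 := g3 n hn3 s hst
  have e2 := dist_eq_gromovProd w y (γ s)
  have e3 : dist (γ s) w = s := by
    rw [← g2]; exact g1.dist_zero hst
  rw [e3, gromovProd_comm] at e2
  rcases lt_abs.1 hn1 with hlt | hlt
  · rcases h.chain w (γ s) (x n) (z n) y with h4 | h4 | h4
    · linarith
    · linarith [hst.2]
    · rw [gromovProd_comm w (z n)] at h4; linarith
  · have := hy.1
    rcases h.chain w (x n) (γ s) y (z n) with h4 | h4 | h4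
    · rw [gromovProd_comm w (x n)] at h4; linarith
    · linarith
    · linarith

/-- A sequence of tubes around geodesics from `w`, at disjoint ranges of heights. -/
structure TubeSystem (w : X) (D : ℝ) where
  a : ℕ → ℝ
  S : ℕ → ℝ
  γ : ℕ → ℝ → X
  a_nonneg : ∀ n, 0 ≤ a n
  S_nonneg : ∀ n, 0 ≤ S n
  geodesic : ∀ n, IsGeodesicOn (γ n) (Set.Icc 0 (a n + S n))
  zero : ∀ n, γ n 0 = w
  sep : ∀ m n, m < n → a m + S m + 2 ≤ a n
  gap : ∀ n y, dist y w ∈ Set.Icc (a n) (a n + S n) → dist y (γ n (dist y w)) ≤ D + 2 →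
    dist y (γ n (dist y w)) ≤ D

namespace TubeSystem

variable (T : TubeSystem w D)

/-- The heights of the `n`-th tube. -/
def I (n : ℕ) : Set ℝ := Set.Icc (T.a n) (T.a n + T.S n)

/-- The `n`-th tube. -/
def InTube (n : ℕ) (x : X) : Prop := dist x w ∈ T.I n ∧ dist x (T.γ n (dist x w)) ≤ D

/-- Families of `2`-Lipschitz self-maps of the height intervals fixing the end points. -/
structure IsProfile (φ : ℕ → ℝ → ℝ) : Prop where
  left : ∀ n, φ n (T.a n) = T.a n
  right : ∀ n, φ n (T.a n + T.S n) = T.a n + T.S n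
  maps : ∀ n, ∀ s ∈ T.I n, φ n s ∈ T.I n
  lip : ∀ n s t, |φ n s - φ n t| ≤ 2 * |s - t|

open scoped Classical in
/-- Move the points of each tube along its core, as prescribed by `φ`. -/
noncomputable def shift (φ : ℕ → ℝ → ℝ) (x : X) : X :=
  if h : ∃ n, T.InTube n x then T.γ h.choose (φ h.choose (dist x w)) else x

lemma I_subset (n : ℕ) : T.I n ⊆ Set.Icc 0 (T.a n + T.S n) :=
  Set.Icc_subset_Icc_left (T.a_nonneg n)

lemma dist_core {n : ℕ} {s t : ℝ} (hs : s ∈ T.I n) (ht : t ∈ T.I n) :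
    dist (T.γ n s) (T.γ n t) = |s - t| :=
  T.geodesic n s (T.I_subset n hs) t (T.I_subset n ht)

lemma dist_core_base {n : ℕ} {s : ℝ} (hs : s ∈ T.I n) : dist (T.γ n s) w = s := by
  have := (T.geodesic n).dist_zero (T.I_subset n hs)
  rwa [T.zero] at this

lemma eq_of_abs_sub_le {m n : ℕ} {s t : ℝ} (hs : s ∈ T.I m) (ht : t ∈ T.I n)
    (hst : |s - t| ≤ 1) : m = n := by
  obtain ⟨h1, h2⟩ := abs_le.1 hst
  rcases lt_trichotomy m n with hlt | heq | hgt
  · linarith [T.sep m n hlt, hs.2, ht.1]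
  · exact heq
  · linarith [T.sep n m hgt, ht.2, hs.1]

lemma shift_of_inTube (φ : ℕ → ℝ → ℝ) {n : ℕ} {x : X} (hx : T.InTube n x) :
    T.shift φ x = T.γ n (φ n (dist x w)) := by
  have h : ∃ n, T.InTube n x := ⟨n, hx⟩
  rw [shift, dif_pos h, T.eq_of_abs_sub_le h.choose_spec.1 hx.1 (by simp)]

lemma shift_of_not (φ : ℕ → ℝ → ℝ) {x : X} (hx : ∀ n, ¬ T.InTube n x) : T.shift φ x = x := by
  rw [shift, dif_neg (by simpa using hx)]

lemma inTube_core (hD : 0 ≤ D) {n : ℕ} {s : ℝ} (hs : s ∈ T.I n) : T.InTube n (T.γ n s) := by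
  rw [InTube, T.dist_core_base hs]
  exact ⟨hs, by simpa using hD⟩

-- By the gap, a neighbour of a tube point can leave the tube only by leaving its range of heights.
-- The tube point is then within `1` in height of an end of the range, where the profile has a fixed
-- point, so it moves by a bounded amount.
variable {T} in
lemma IsProfile.dist_shift_le_aux {φ : ℕ → ℝ → ℝ} (hφ : T.IsProfile φ) {x y : X}
    (hxy : dist x y ≤ 1) {n : ℕ} (hx : T.InTube n x) (hy : ∀ n, ¬ T.InTube n y) :
    dist (T.shift φ x) y ≤ D + 4 := by
  rw [T.shift_of_inTube φ hx]
  have hh := (abs_dist_sub_le x y w).trans hxy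
  obtain ⟨hh1, hh2⟩ := abs_le.1 hh
  have hyn : dist y w ∉ T.I n := by
    intro hyn
    refine hy n ⟨hyn, T.gap n y hyn ?_⟩
    have e1 := T.dist_core hx.1 hyn
    have e2 := dist_triangle4 y x (T.γ n (dist x w)) (T.γ n (dist y w))
    linarith [hx.2, dist_comm x y]
  have hdisp : |φ n (dist x w) - dist x w| ≤ 3 := by
    have hmem := hx.1
    have key : ∀ e, φ n e = e → |dist x w - e| ≤ 1 → |φ n (dist x w) - dist x w| ≤ 3 := by
      intro e he hle
      have := hφ.lip n (dist x w) e
      rw [he] at this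
      obtain ⟨h1, h2⟩ := abs_le.1 this
      obtain ⟨h3, h4⟩ := abs_le.1 hle
      rw [abs_le]; constructor <;> linarith
    rcases not_and_or.1 hyn with h1 | h1
    · refine key _ (hφ.left n) ?_
      rw [abs_of_nonneg (by linarith [hmem.1])]; linarith
    · refine key _ (hφ.right n) ?_
      rw [abs_of_nonpos (by linarith [hmem.2])]; linarith
  have e1 := T.dist_core (hφ.maps n _ hx.1) hx.1
  have e2 := dist_triangle4 (T.γ n (φ n (dist x w))) (T.γ n (dist x w)) x y
  linarith [hx.2, dist_comm x (T.γ n (dist x w))]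

variable {T} in
lemma IsProfile.dist_shift_le_of_dist_le_one {φ : ℕ → ℝ → ℝ} (hφ : T.IsProfile φ) (hD : 0 ≤ D)
    {x y : X} (hxy : dist x y ≤ 1) : dist (T.shift φ x) (T.shift φ y) ≤ D + 4 := by
  by_cases hx : ∃ n, T.InTube n x
  · obtain ⟨n, hx⟩ := hx
    by_cases hy : ∃ m, T.InTube m y
    · obtain ⟨m, hy⟩ := hy
      have hh := (abs_dist_sub_le x y w).trans hxy
      obtain rfl := T.eq_of_abs_sub_le hx.1 hy.1 hh
      rw [T.shift_of_inTube φ hx, T.shift_of_inTube φ hy,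
        T.dist_core (hφ.maps n _ hx.1) (hφ.maps n _ hy.1)]
      linarith [hφ.lip n (dist x w) (dist y w)]
    · rw [not_exists] at hy
      rw [T.shift_of_not φ hy]
      exact hφ.dist_shift_le_aux hxy hx hy
  · rw [not_exists] at hx
    rw [T.shift_of_not φ hx]
    by_cases hy : ∃ m, T.InTube m y
    · obtain ⟨m, hy⟩ := hy
      rw [dist_comm] at hxy ⊢
      exact hφ.dist_shift_le_aux hxy hy hx
    · rw [not_exists] at hy
      rw [T.shift_of_not φ hy]
      linarith

end TubeSystem

/-- A map of a geodesic space that is bounded at scale `1` is coarsely Lipschitz. -/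
lemma IsGeodesicSpace.dist_le_of_dist_le_one (hg : IsGeodesicSpace X) {Y : Type v} [MetricSpace Y]
    {F : X → Y} {C : ℝ} (hC : 0 ≤ C) (hF : ∀ x y, dist x y ≤ 1 → dist (F x) (F y) ≤ C)
    (x y : X) : dist (F x) (F y) ≤ C * dist x y + C := by
  have key : ∀ n : ℕ, ∀ x y : X, dist x y ≤ n → dist (F x) (F y) ≤ C * n := by
    intro n
    induction n with
    | zero =>
      intro x y hxy
      have : x = y := dist_le_zero.1 (by simpa using hxy)
      simp [this]
    | succ n ih =>
      intro x y hxy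
      push_cast at hxy ⊢
      obtain ⟨γ, h1, h2, h3⟩ := hg.exists_path x y
      have hd : (0 : ℝ) ≤ dist x y := dist_nonneg
      have hm : min (n : ℝ) (dist x y) ∈ Set.Icc 0 (dist x y) :=
        ⟨le_min (Nat.cast_nonneg _) hd, min_le_right _ _⟩
      have e1 := h1 0 ⟨le_rfl, hd⟩ _ hm
      have e2 := h1 _ hm _ ⟨hd, le_rfl⟩
      rw [h2, zero_sub, abs_neg, abs_of_nonneg hm.1] at e1
      rw [h3, abs_of_nonpos (by linarith [hm.2])] at e2
      have i1 := ih x (γ (min (n : ℝ) (dist x y))) (by rw [e1]; exact min_le_left _ _)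
      have i2 := hF (γ (min (n : ℝ) (dist x y))) y (by
        rw [e2]
        rcases min_choice (n : ℝ) (dist x y) with h | h <;> rw [h] <;> linarith)
      have := dist_triangle (F x) (F (γ (min (n : ℝ) (dist x y)))) (F y)
      linarith
  have h1 := key ⌈dist x y⌉₊ x y (Nat.le_ceil _)
  have h2 := Nat.ceil_lt_add_one (@dist_nonneg _ _ x y)
  nlinarith

namespace TubeSystem

variable {T : TubeSystem w D}

lemma IsProfile.dist_shift_shift_le {φ ψ : ℕ → ℝ → ℝ} (hψ : T.IsProfile ψ) (hD : 0 ≤ D)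
    (hφψ : ∀ n, ∀ s ∈ T.I n, φ n (ψ n s) = s) (x : X) :
    dist (T.shift φ (T.shift ψ x)) x ≤ D := by
  by_cases hx : ∃ n, T.InTube n x
  · obtain ⟨n, hx⟩ := hx
    have hm := hψ.maps n _ hx.1
    rw [T.shift_of_inTube ψ hx, T.shift_of_inTube φ (T.inTube_core hD hm), T.dist_core_base hm,
      hφψ n _ hx.1, dist_comm]
    exact hx.2
  · rw [not_exists] at hx
    rw [T.shift_of_not ψ hx, T.shift_of_not φ hx, dist_self]
    exact hD

/-- The shifts by inverse profiles are coarsely Lipschitz and inverse to each other up to `D`, the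
cost of projecting a tube onto its core. -/
lemma IsProfile.isQuasiIsometry {φ ψ : ℕ → ℝ → ℝ} (hφ : T.IsProfile φ) (hψ : T.IsProfile ψ)
    (hD : 0 ≤ D) (hg : IsGeodesicSpace X) (hφψ : ∀ n, ∀ s ∈ T.I n, φ n (ψ n s) = s)
    (hψφ : ∀ n, ∀ s ∈ T.I n, ψ n (φ n s) = s) :
    IsQuasiIsometry (D + 4) (3 * D + 4) (T.shift φ) := by
  refine ⟨⟨by linarith, by linarith, fun x y => ⟨?_, ?_⟩⟩, fun y => ⟨T.shift ψ y, ?_⟩⟩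
  · have h1 := hg.dist_le_of_dist_le_one (by linarith)
      (fun x y => hψ.dist_shift_le_of_dist_le_one hD (x := x) (y := y)) (T.shift φ x) (T.shift φ y)
    have h2 := hφ.dist_shift_shift_le hD hψφ x
    have h3 := hφ.dist_shift_shift_le hD hψφ y
    have h4 := dist_triangle4 x (T.shift ψ (T.shift φ x)) (T.shift ψ (T.shift φ y)) y
    rw [dist_comm x (T.shift ψ _)] at h4
    have h5 : (D + 4)⁻¹ * dist x y ≤ dist (T.shift φ x) (T.shift φ y) + (3 * D + 4) := by
      rw [inv_mul_le_iff₀ (by linarith)]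
      nlinarith
    linarith
  · have h1 := hg.dist_le_of_dist_le_one (by linarith)
      (fun x y => hφ.dist_shift_le_of_dist_le_one hD (x := x) (y := y)) x y
    linarith
  · rw [dist_comm]
    linarith [hψ.dist_shift_shift_le hD hφψ y]

lemma two_mul_le_a (T : TubeSystem w D) (n : ℕ) : 2 * (n : ℝ) ≤ T.a n := by
  induction n with
  | zero => simpa using T.a_nonneg 0
  | succ n ih =>
    have := T.sep n (n + 1) (Nat.lt_succ_self n)
    push_cast
    linarith [T.S_nonneg n]

lemma IsProfile.le_gromovProd_shift {φ : ℕ → ℝ → ℝ} (hφ : T.IsProfile φ) {n : ℕ} {x : X}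
    (hx : T.InTube n x) : T.a n - D ≤ gromovProd w x (T.shift φ x) := by
  rw [T.shift_of_inTube φ hx]
  have hm := hφ.maps n _ hx.1
  have e1 := gromovProd_left_le w (T.γ n (dist x w)) (T.γ n (φ n (dist x w))) x
  have e2 : T.a n ≤ gromovProd w (T.γ n (dist x w)) (T.γ n (φ n (dist x w))) := by
    rw [gromovProd, T.dist_core_base hx.1, T.dist_core_base hm, T.dist_core hx.1 hm]
    have h1 := hx.1.1
    have h2 := hm.1
    rcases le_total (dist x w) (φ n (dist x w)) with h | h
    · rw [abs_of_nonpos (by linarith)]; linarith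
    · rw [abs_of_nonneg (by linarith)]; linarith
  linarith [hx.2, dist_comm x (T.γ n (dist x w))]

/-- A point of the `n`-th tube and its image follow one geodesic from `w` up to height `T.a n`. A
sequence going to infinity eventually avoids any given tube, and `T.a n` tends to infinity. -/
lemma IsProfile.inducesBoundaryMap {φ : ℕ → ℝ → ℝ} (hφ : T.IsProfile φ) (h : FourPoint X δ) :
    InducesBoundaryMap (T.shift φ) id := by
  intro x ξ hx
  refine h.represents_of_asymptotic hx
    (h.asymptotic_of_tendsto hx.isGromovSeq.asymptotic_self fun v => ?_)
  rw [Filter.tendsto_atTop]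
  intro A
  set A' := A + dist v w with hA'
  set N := ⌈A' + D⌉₊ with hN
  obtain ⟨M, hM⟩ := hx.isGromovSeq.asymptotic_self.eventually_le_dist w (max A' (T.a N))
  refine Filter.eventually_atTop.2 ⟨M, fun i hi => ?_⟩
  have hi1 := (le_max_left _ _).trans (hM i hi)
  have hi2 := (le_max_right _ _).trans (hM i hi)
  have hw : A' ≤ gromovProd w (x i) (T.shift φ (x i)) := by
    by_cases hin : ∃ n, T.InTube n (x i)
    · obtain ⟨n, hn⟩ := hin
      have hNn : N ≤ n := by
        by_contra! hlt
        linarith [T.sep n N hlt, hn.1.2]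
      have e1 := hφ.le_gromovProd_shift hn
      have e2 := T.two_mul_le_a n
      have e3 : (N : ℝ) ≤ n := by exact_mod_cast hNn
      have e4 := Nat.le_ceil (A' + D)
      have e5 : (0 : ℝ) ≤ n := Nat.cast_nonneg n
      linarith
    · rw [not_exists] at hin
      rw [T.shift_of_not φ hin, gromovProd_self]
      exact hi1
  have := gromovProd_base_le w v (x i) (T.shift φ (x i))
  change A ≤ gromovProd v (x i) (T.shift φ (x i))
  linarith

/-- The profile stretching the lower third of each tube by the factor `2`. -/
noncomputable def stretch (T : TubeSystem w D) (n : ℕ) (s : ℝ) : ℝ :=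
  T.a n + min (2 * (s - T.a n)) ((s - T.a n + T.S n) / 2)

/-- The inverse of `TubeSystem.stretch`. -/
noncomputable def unstretch (T : TubeSystem w D) (n : ℕ) (s : ℝ) : ℝ :=
  T.a n + max ((s - T.a n) / 2) (2 * (s - T.a n) - T.S n)

lemma isProfile_stretch (T : TubeSystem w D) : T.IsProfile T.stretch where
  left n := by simp [stretch, T.S_nonneg n, div_nonneg]
  right n := by
    have := T.S_nonneg n
    rw [stretch, min_eq_right (by linarith)]; ring
  maps n s hs := by
    obtain ⟨h1, h2⟩ := hs
    constructor
    · simp only [stretch]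
      have : 0 ≤ min (2 * (s - T.a n)) ((s - T.a n + T.S n) / 2) :=
        le_min (by linarith) (by linarith [T.S_nonneg n])
      linarith
    · simp only [stretch]
      linarith [min_le_right (2 * (s - T.a n)) ((s - T.a n + T.S n) / 2)]
  lip n s t := by
    have := abs_min_sub_min_le_max (2 * (s - T.a n)) ((s - T.a n + T.S n) / 2)
      (2 * (t - T.a n)) ((t - T.a n + T.S n) / 2)
    simp only [stretch, add_sub_add_left_eq_sub]
    refine this.trans (max_le ?_ ?_)
    · rw [show 2 * (s - T.a n) - 2 * (t - T.a n) = 2 * (s - t) by ring, abs_mul]; simp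
    · rw [show (s - T.a n + T.S n) / 2 - (t - T.a n + T.S n) / 2 = (1 / 2) * (s - t) by ring,
        abs_mul]
      norm_num
      linarith [abs_nonneg (s - t)]

lemma isProfile_unstretch (T : TubeSystem w D) : T.IsProfile T.unstretch where
  left n := by simp [unstretch, T.S_nonneg n]
  right n := by
    have := T.S_nonneg n
    rw [unstretch, max_eq_right (by linarith)]; ring
  maps n s hs := by
    obtain ⟨h1, h2⟩ := hs
    constructor
    · simp only [unstretch]
      linarith [le_max_left ((s - T.a n) / 2) (2 * (s - T.a n) - T.S n)]
    · simp only [unstretch]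
      have : max ((s - T.a n) / 2) (2 * (s - T.a n) - T.S n) ≤ T.S n :=
        max_le (by linarith [T.S_nonneg n]) (by linarith)
      linarith
  lip n s t := by
    have := abs_max_sub_max_le_max ((s - T.a n) / 2) (2 * (s - T.a n) - T.S n)
      ((t - T.a n) / 2) (2 * (t - T.a n) - T.S n)
    simp only [unstretch, add_sub_add_left_eq_sub]
    refine this.trans (max_le ?_ ?_)
    · rw [show (s - T.a n) / 2 - (t - T.a n) / 2 = (1 / 2) * (s - t) by ring, abs_mul]
      norm_num
      linarith [abs_nonneg (s - t)]
    · rw [show 2 * (s - T.a n) - T.S n - (2 * (t - T.a n) - T.S n) = 2 * (s - t) by ring, abs_mul]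
      simp

lemma stretch_unstretch (T : TubeSystem w D) (n : ℕ) (s : ℝ) :
    T.stretch n (T.unstretch n s) = s := by
  simp only [stretch, unstretch, add_sub_cancel_left]
  rcases le_total ((s - T.a n) / 2) (2 * (s - T.a n) - T.S n) with h | h
  · rw [max_eq_right h, min_eq_right (by linarith)]; ring
  · rw [max_eq_left h, min_eq_left (by linarith)]; ring

lemma unstretch_stretch (T : TubeSystem w D) (n : ℕ) (s : ℝ) :
    T.unstretch n (T.stretch n s) = s := by
  simp only [stretch, unstretch, add_sub_cancel_left]
  rcases le_total (2 * (s - T.a n)) ((s - T.a n + T.S n) / 2) with h | h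
  · rw [min_eq_left h, max_eq_left (by linarith)]; ring
  · rw [min_eq_right h, max_eq_right (by linarith)]; ring

lemma exists_dist_shift_stretch (T : TubeSystem w D) (hD : 0 ≤ D) (n : ℕ) :
    ∃ x, dist x (T.shift T.stretch x) = T.S n / 3 := by
  have hS := T.S_nonneg n
  have hs : T.a n + T.S n / 3 ∈ T.I n := ⟨by linarith, by linarith⟩
  have ht : T.a n + 2 * T.S n / 3 ∈ T.I n := ⟨by linarith, by linarith⟩
  refine ⟨T.γ n (T.a n + T.S n / 3), ?_⟩
  rw [T.shift_of_inTube _ (T.inTube_core hD hs), T.dist_core_base hs]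
  have : T.stretch n (T.a n + T.S n / 3) = T.a n + 2 * T.S n / 3 := by
    rw [stretch, min_eq_left (by linarith)]; ring
  rw [this, T.dist_core hs ht, abs_of_nonpos (by linarith)]
  ring

end TubeSystem

lemma IsVisual.exists_tubeSystem (hV : IsVisual w) (hU : ¬ BranchesUniformly w)
    (h : FourPoint X δ) (hg : IsGeodesicSpace X) :
    ∃ D : ℝ, 0 ≤ D ∧ ∃ T : TubeSystem w D, ∀ n, T.S n = n := by
  obtain ⟨D, hD, htube⟩ := hV.exists_tube hU h hg
  refine ⟨D, hD, ?_⟩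
  choose A g h1 h2 h3 h4 using fun (n : ℕ) (t : ℝ) =>
    htube n (max t 0) (Nat.cast_nonneg n) (le_max_right _ _)
  -- Each tube starts at least `2` above the top of the previous one, and the `n`-th has length `n`,
  -- so that displacements are unbounded.
  let b : ℕ → ℝ := fun n => Nat.rec 0 (fun n t => A n t + n + 2) n
  have hab : ∀ n, b n ≤ A n (b n) := fun n => (le_max_left _ _).trans (h1 n (b n))
  have hmono : Monotone b := monotone_nat_of_le_succ fun n => by
    change b n ≤ A n (b n) + n + 2
    linarith [hab n, (Nat.cast_nonneg n : (0 : ℝ) ≤ n)]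
  exact ⟨{
    a := fun n => A n (b n)
    S := fun n => n
    γ := fun n => g n (b n)
    a_nonneg := fun n => (le_max_right _ _).trans (h1 n (b n))
    S_nonneg := fun n => Nat.cast_nonneg n
    geodesic := fun n => h2 n (b n)
    zero := fun n => h3 n (b n)
    sep := fun m n hmn => (hmono (Nat.succ_le_of_lt hmn)).trans (hab n)
    gap := fun n => h4 n (b n) }, fun n => rfl⟩

lemma IsBoundaryRigid.branchesUniformly (hR : IsBoundaryRigid X) (hV : IsVisual w)
    (h : FourPoint X δ) (hg : IsGeodesicSpace X) : BranchesUniformly w := by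
  by_contra hU
  obtain ⟨D, hD, T, hT⟩ := hV.exists_tubeSystem hU h hg
  obtain ⟨M, hM⟩ := hR _ _ _ (T.isProfile_stretch.isQuasiIsometry T.isProfile_unstretch hD hg
    (fun n s _ => T.stretch_unstretch n s) (fun n s _ => T.unstretch_stretch n s))
    (T.isProfile_stretch.inducesBoundaryMap h)
  obtain ⟨n, hn⟩ := exists_nat_gt (3 * M)
  obtain ⟨x, hx⟩ := T.exists_dist_shift_stretch hD n
  have := hM x
  rw [hx, hT] at this
  linarith

end Tubes

end GromovHyp

theorem mainTheorem7 (X : Type u) [MetricSpace X] [ProperSpace X]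
    (hgeod : GromovHyp.IsGeodesicSpace X)
    (δ : ℝ) (hδ : GromovHyp.IsDeltaHyperbolic X δ)
    (hpole : GromovHyp.HasPole X)
    (w : X) (ε : ℝ) (hε0 : 0 < ε) (hε1 : ε < 1) (hεδ : 5 * δ * ε < 1) :
    List.TFAE
      [GromovHyp.EmbedsInRichSpace.{u, v} X,
       GromovHyp.IsGeodesicallyRich X,
       GromovHyp.IsUniformlyPerfect (GromovHyp.visualDist (X := X) w ε),
       GromovHyp.IsBoundaryRigid X] := by
  have h := hδ.fourPoint hgeod
  have hV := hpole.isVisual h w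
  -- The four-point constant is `3δ`, and `5 * δ * ε < 1` gives `3δε < 3/5 < log 2`, as Frink's
  -- inequality requires.
  have hK : Real.exp (ε * (3 * δ)) ≤ 2 := by
    have h1 : Real.exp (ε * (3 * δ)) ≤ Real.exp (Real.log 2) :=
      Real.exp_le_exp.2 (by linarith [Real.log_two_gt_d9])
    rwa [Real.exp_log (by norm_num)] at h1
  tfae_have 2 → 1 := fun hr => hr.embedsInRichSpace hδ
  tfae_have 1 → 3 := by
    rintro ⟨Y, _, hY, ⟨δ', hδ'⟩, K, C, f, F, hf, hF, hbij⟩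
    exact (hf.branchesUniformly hF hbij.2 h hgeod (hδ'.fourPoint hY.1) hY w).isUniformlyPerfect
      h hε0 hK
  tfae_have 3 → 2 := fun hp =>
    ((hp.branchesUniformly h hε0 hK).isCenteredByTriples hV h).isGeodesicallyRich h hgeod
  tfae_have 3 → 4 := fun hp =>
    ((hp.branchesUniformly h hε0 hK).isCenteredByTriples hV h).isBoundaryRigid h hgeod
  tfae_have 4 → 3 := fun hr => (hr.branchesUniformly hV h hgeod).isUniformlyPerfect h hε0 hK
  tfae_finish
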